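/- Let $k\ge 2$ be a fixed integer and let $\alpha>\beta>0$ be fixed real constants. For even $n$, let $V=[n]$ and $$p=\frac{\alpha\log n}{\binom{n-1}{k-1}},\qquad q=\frac{\beta\log n}{\binom{n-1}{k-1}},$$ which lie in $[0,1]$ for all large $n$. Let $(\sigma,\mathcal H)$ be distributed as follows: $\sigma$ is uniform among the vectors in $\{\pm1\}^V$ with $\sum_i\sigma_i=0$, and, given $\sigma$, $\mathcal H$ is the random $k$-uniform hypergraph on $V$ in which every $k$-element set $e\subseteq V$ is independently a hyperedge, with probability $p$ if $\sigma$ is constant on $e$ and with probability $q$ otherwise. For a $k$-uniform hypergraph $H$ on $V$ and $i\ne j$ in $V$ let $w(ij)$ be the number of hyperedges of $H$ that contain both $i$ and $j$. Let $\widehat\sigma_{trunc}(H)$ be any optimal solution (ties broken arbitrarily as a function of $H$) of $$\max\ \sum_{i<j}w(ij)x_ix_j\quad\text{subject to } x\in\{\pm1\}^V,\ \sum_i x_i=0,$$ that is, a minimum bisection of the weighted graph $(G_H,w)$, and let $\widehat\Sigma(H)$ be any optimal solution of its semidefinite relaxation $$\max\ \sum_{i<j}w(ij)X_{ij}\quad\text{subject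 to } \sum_{i,j}X_{ij}=0,\ X_{ii}=1\text{ for all } i,\ X=X^T\succeq0 .$$ Put $$I_2(\alpha,\beta)=\max_{t\ge0}\frac1{2^{k-1}}\left[\alpha\left(1-e^{-(k-1)t}\right)+\sum_{r=1}^{k-1}\beta\binom{k-1}{r}\left(1-e^{-(k-1-2r)t}\right)\right]$$ (the maximum is attained). As $n\to\infty$ along the even integers: (i) if $I_2(\alpha,\beta)<1$, then $\Pr\big(\widehat\sigma_{trunc}(\mathcal H)\notin\{\sigma,-\sigma\}\big)=1-o(1)$, and also $\Pr\big(\widehat\Sigma(\mathcal H)\ne\sigma\sigma^T\big)=1-o(1)$; (ii) if $I_2(\alpha,\beta)>1$, then $\Pr\big(\widehat\sigma_{trunc}(\mathcal H)\in\{\sigma,-\sigma\}\big)=1-o(1)$. -/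

import Mathlib

open MeasureTheory ProbabilityTheory Filter Topology
open scoped unitInterval

namespace HSBM

noncomputable section

/-- Sign vectors `x ∈ {±1}^V` on the vertex set `V = [n]`; the group `ℤˣ` is `{1, -1}`. -/
abbrev Labeling (n : ℕ) : Type := Fin n → ℤˣ

/-- The `k`-element subsets of the vertex set. -/
abbrev KSet (n k : ℕ) : Type := {e : Finset (Fin n) // e.card = k}

/-- A `k`-uniform hypergraph on `[n]`, given by the indicator of its edge set. -/
abbrev Hypergraph (n k : ℕ) : Type := KSet n k → Bool

/-- The balanced sign vectors, those with `∑ i, x i = 0`. -/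
def balanced (n : ℕ) : Set (Labeling n) := {x | ∑ i, ((x i : ℤˣ) : ℤ) = 0}

/-- All the vertices of `e` have the same label. -/
def InCluster {n : ℕ} (x : Labeling n) (e : Finset (Fin n)) : Prop :=
  ∀ i ∈ e, ∀ j ∈ e, x i = x j

open scoped Classical in
/-- The probability that `e` is a hyperedge, given the labels. -/
def edgeProb {n : ℕ} (p q : I) (x : Labeling n) (e : Finset (Fin n)) : I :=
  if InCluster x e then p else q

/-- All subsets of `ℤˣ` are measurable. -/
instance : MeasurableSingletonClass ℤˣ where
  measurableSet_singleton x :=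
    ⟨{(x : ℤ)}, measurableSet_singleton _, by ext y; simp [Units.val_inj]⟩

/-- The law of the hypergraph given the labels: every `k`-set is a hyperedge independently. -/
def hypergraphLaw (n k : ℕ) (p q : I) (x : Labeling n) : Measure (Hypergraph n k) :=
  Measure.pi fun e => bernoulliMeasure true false (edgeProb p q x e)

/-- The `k`-uniform stochastic block model, as the joint law of the pair `(σ, H)`: the labels `σ`
are uniform among the balanced sign vectors, and `H` is sampled given `σ`. -/
def hsbm (n k : ℕ) (p q : I) : Measure (Labeling n × Hypergraph n k) :=
  uniformOn (balanced n) ⊗ₘ Kernel.ofFunOfCountable (hypergraphLaw n k p q)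

instance (n k : ℕ) (p q : I) (x : Labeling n) :
    IsProbabilityMeasure (hypergraphLaw n k p q x) := by
  unfold hypergraphLaw; infer_instance

instance (n k : ℕ) (p q : I) :
    IsMarkovKernel (Kernel.ofFunOfCountable (hypergraphLaw n k p q)) :=
  ⟨fun x => inferInstanceAs (IsProbabilityMeasure (hypergraphLaw n k p q x))⟩

/-- The weight `w(ij)`: the number of hyperedges that contain both `i` and `j`. -/
def weight {n k : ℕ} (H : Hypergraph n k) (i j : Fin n) : ℕ :=
  Fintype.card {e : KSet n k // H e = true ∧ i ∈ e.1 ∧ j ∈ e.1}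

/-- The objective `∑_{i<j} w(ij) x_i x_j`. -/
def bisectionObj {n k : ℕ} (H : Hypergraph n k) (x : Labeling n) : ℤ :=
  ∑ i, ∑ j ∈ Finset.Ioi i, (weight H i j : ℤ) * ((x i : ℤˣ) : ℤ) * ((x j : ℤˣ) : ℤ)

/-- `x` maximizes `∑_{i<j} w(ij) x_i x_j` among the balanced sign vectors, that is, `x` is a
minimum bisection of the weighted graph. -/
def IsMinBisection {n k : ℕ} (H : Hypergraph n k) (x : Labeling n) : Prop :=
  x ∈ balanced n ∧ ∀ y ∈ balanced n, bisectionObj H y ≤ bisectionObj H x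

/-- The feasible set of the semidefinite program. -/
def sdpFeasible (n : ℕ) : Set (Matrix (Fin n) (Fin n) ℝ) :=
  {X | ∑ i, ∑ j, X i j = 0 ∧ (∀ i, X i i = 1) ∧ X.PosSemidef}

/-- The objective `∑_{i<j} w(ij) X_ij`. -/
def sdpObj {n k : ℕ} (H : Hypergraph n k) (X : Matrix (Fin n) (Fin n) ℝ) : ℝ :=
  ∑ i, ∑ j ∈ Finset.Ioi i, (weight H i j : ℝ) * X i j

/-- `X` is an optimal solution of the semidefinite program. -/
def IsSDPOptimal {n k : ℕ} (H : Hypergraph n k) (X : Matrix (Fin n) (Fin n) ℝ) : Prop :=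
  X ∈ sdpFeasible n ∧ ∀ Y ∈ sdpFeasible n, sdpObj H Y ≤ sdpObj H X

/-- The rank-one matrix `x xᵀ`. -/
def outer {n : ℕ} (x : Labeling n) : Matrix (Fin n) (Fin n) ℝ :=
  Matrix.of fun i j => (((x i : ℤˣ) : ℤ) : ℝ) * (((x j : ℤˣ) : ℤ) : ℝ)

/-- The function of `t` whose maximum over `t ≥ 0` is `I₂(α, β)`. -/
def rate (k : ℕ) (α β t : ℝ) : ℝ :=
  1 / 2 ^ (k - 1) * (α * (1 - Real.exp (-((k : ℝ) - 1) * t)) +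
    ∑ r ∈ Finset.Icc 1 (k - 1),
      β * ((k - 1).choose r : ℝ) * (1 - Real.exp (-((k : ℝ) - 1 - 2 * r) * t)))

/-- `I₂(α, β)`. -/
def I₂ (k : ℕ) (α β : ℝ) : ℝ := sSup (rate k α β '' Set.Ici 0)

end

end HSBM

/-!
Write `n = 2 m`, `L = log n`, and let `s_e` be the sum of the labels of a hyperedge `e`. The
objective of `x` is `∑_{e ∈ H} (s_e ^ 2 - k) / 2`, so replacing `x` by `y` changes it by a sum of
independent contributions `gain x y e` of the hyperedges. If `y` reverses `x` on `A` and `e ∩ A =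
{i}`, the gain is `-2 * loc x i e`, where `loc x i e = k - 1 - 2 r` when `r` vertices of `e` have
the label opposite to that of `i`; by counting, the exponent `∑_{e ∋ i} p_e (1 - exp (-t * loc x i
e))` is asymptotic to `rate t * L`. All estimates are made for a fixed balanced `x = σ`, uniformly
in `x`, and then averaged. What matters is whether `σ` is beaten by a balanced `y ≠ ±σ`.

*Above the threshold.* Up to a global sign every competitor is `flip A x` with `#A ≤ m`. For `#A ≤
η m` few hyperedges meet `A` twice, so Chernoff's bound is close to `n ^ (-rate t * #A)` with `rate
t = I₂ > 1` (`measure_flip_le_small`), and the sum over `A` is at most `(1 + n ^ (-1 - δ)) ^ n -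
1`. For larger `A`, the sum of `s_e ^ 2` over all `k`-sets is the same for all balanced labels, so
the mean gain only sees the excess `p - q` inside the clusters and is at most a negative multiple
of `n L`. Chernoff's bound with a small parameter (`measure_flip_le_large`) then beats the `2 ^ n`
competitors.

*Below the threshold.* Take `n ^ γ'` vertices on each side, with union `S`. Whether `i ∈ S` gains
by changing sides, judged by the hyperedges that meet `S` in `i` alone, is decided by disjoint sets
of hyperedges for different `i`, and it happens with probability at least `n ^ (-γ)` with `γ < γ'`.
This lower bound (`exp_moment_sub_le_measure_linStat_neg`) uses only exponential moments: with `t`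
a little to the right of the maximizer of the rate, the moment at `t` cannot come from the events
where the statistic is nonnegative or very negative, as the moments at `t - u` and `t + u` show. So
with high probability there are such vertices on both sides; the hyperedges with two or
more vertices in `S` are independent of this choice, so with high probability none of them contains
the two chosen vertices (`measure_forall_not_le`), and exchanging these strictly improves `σ`. Then
`σ` is not a minimum bisection, and since the sign vectors embed into the semidefinite program with
the same objective, `σσᵀ` is not optimal there.
-/

namespace HSBM

/-! ### Products of Bernoulli laws -/

theorem exp_neg_sub_sq_le_one_sub {x : ℝ} (h : |x| ≤ 1 / 2) :
    Real.exp (-x - 2 * x ^ 2) ≤ 1 - x := by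
  obtain ⟨h1, h2⟩ := abs_le.1 h
  have h3 := Real.add_one_le_exp (x + 2 * x ^ 2)
  have h4 : 1 ≤ (1 - x) * Real.exp (x + 2 * x ^ 2) := by
    nlinarith [mul_nonneg (sq_nonneg x) (by linarith : 0 ≤ 1 / 2 - x),
      mul_le_mul_of_nonneg_left h3 (by linarith : 0 ≤ 1 - x)]
  rw [show -x - 2 * x ^ 2 = -(x + 2 * x ^ 2) by ring, Real.exp_neg]
  exact (inv_le_iff_one_le_mul₀ (Real.exp_pos _)).2 h4

theorem exp_le_prod_one_sub {ι : Type*} (s : Finset ι) (x : ι → ℝ)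
    (h : ∀ e ∈ s, |x e| ≤ 1 / 2) :
    Real.exp (-∑ e ∈ s, x e - 2 * ∑ e ∈ s, x e ^ 2) ≤ ∏ e ∈ s, (1 - x e) := by
  rw [Finset.mul_sum, ← Finset.sum_neg_distrib, ← Finset.sum_sub_distrib, Real.exp_sum]
  exact Finset.prod_le_prod (fun e _ => (Real.exp_pos _).le)
    fun e he => exp_neg_sub_sq_le_one_sub (h e he)

theorem prod_one_sub_le_exp {ι : Type*} (s : Finset ι) (x : ι → ℝ) (h : ∀ e ∈ s, x e ≤ 1) :
    ∏ e ∈ s, (1 - x e) ≤ Real.exp (-∑ e ∈ s, x e) := by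
  rw [← Finset.sum_neg_distrib, Real.exp_sum]
  refine Finset.prod_le_prod (fun e he => by linarith [h e he]) fun e _ => ?_
  have := Real.add_one_le_exp (-x e)
  linarith

section Bernoulli

variable {ι : Type*} [Fintype ι]

/-- The law of independent indicators, with success probabilities `P`. -/
noncomputable def bernoulliPi (P : ι → I) : Measure (ι → Bool) :=
  Measure.pi fun e => bernoulliMeasure true false (P e)

instance (P : ι → I) : IsProbabilityMeasure (bernoulliPi P) := by
  unfold bernoulliPi; infer_instance

theorem integrable_bernoulliPi (P : ι → I) (f : (ι → Bool) → ℝ) :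
    Integrable f (bernoulliPi P) := Integrable.of_finite

theorem measurableSet_bool_pi (E : Set (ι → Bool)) : MeasurableSet E :=
  E.toFinite.measurableSet

/-- The linear statistic `∑ e, c e * 1[H e]`. -/
noncomputable def linStat (c : ι → ℝ) (H : ι → Bool) : ℝ := ∑ e, if H e then c e else 0

theorem linStat_smul (t : ℝ) (c : ι → ℝ) (H : ι → Bool) :
    linStat (fun e => t * c e) H = t * linStat c H := by
  simp only [linStat, Finset.mul_sum]
  refine Finset.sum_congr rfl fun e _ => ?_
  split_ifs <;> simp

/-- The exponential moment of a linear statistic of independent indicators. -/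
theorem integral_exp_linStat (P : ι → I) (c : ι → ℝ) :
    ∫ H, Real.exp (linStat c H) ∂bernoulliPi P
      = ∏ e, (1 - (P e : ℝ) * (1 - Real.exp (c e))) := by
  have h : ∀ H : ι → Bool, Real.exp (linStat c H)
      = ∏ e, (fun (e : ι) (b : Bool) => Real.exp (if b then c e else 0)) e (H e) := fun H => by
    simp [linStat, Real.exp_sum]
  rw [integral_congr_ae (Eventually.of_forall h), bernoulliPi]
  refine (integral_fintype_prod_eq_prod (𝕜 := ℝ) (μ := fun e => bernoulliMeasure true false (P e))
    fun (e : ι) (b : Bool) => Real.exp (if b then c e else 0)).trans ?_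
  refine Finset.prod_congr rfl fun e _ => ?_
  rw [integral_bernoulliMeasure]
  simp
  ring

theorem bernoulli_factor_nonneg (a : I) (x : ℝ) : 0 ≤ 1 - (a : ℝ) * (1 - Real.exp x) := by
  have h0 := a.2.1
  have h1 := a.2.2
  nlinarith [mul_nonneg h0 (Real.exp_pos x).le]

/-- Chernoff's bound for a linear statistic of independent indicators. -/
theorem measure_linStat_nonneg_le (P : ι → I) (c : ι → ℝ) :
    (bernoulliPi P).real {H | 0 ≤ linStat c H}
      ≤ Real.exp (-∑ e, (P e : ℝ) * (1 - Real.exp (c e))) := by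
  have h1 : (bernoulliPi P).real {H | 0 ≤ linStat c H}
      ≤ ∫ H, Real.exp (linStat c H) ∂bernoulliPi P := by
    rw [← integral_indicator_one (measurableSet_bool_pi _)]
    refine integral_mono (integrable_bernoulliPi P _) (integrable_bernoulliPi P _) fun H => ?_
    by_cases hH : 0 ≤ linStat c H
    · simp [Set.indicator, hH]
    · simp only [Set.indicator, Set.mem_ofPred_eq, hH, if_false]
      positivity
  refine h1.trans ?_
  rw [integral_exp_linStat, ← Finset.sum_neg_distrib, Real.exp_sum]
  refine Finset.prod_le_prod (fun e _ => bernoulli_factor_nonneg _ _) fun e _ => ?_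
  have := Real.add_one_le_exp (-((P e : ℝ) * (1 - Real.exp (c e))))
  linarith

/-- A lower bound for the probability that a linear statistic is negative, in terms of its
exponential moments alone. On `{D ≥ 0}` the weight `exp (-tD)` is at most `exp (-(t-u)D)`, on
`{D < -a}` it is at most `exp (-ua) * exp (-(t+u)D)`, and on the rest it is at most `exp (ta)`. -/
theorem exp_moment_sub_le_measure_linStat_neg (P : ι → I) (d : ι → ℝ) {t u a : ℝ}
    (ht : 0 ≤ t) (hu : 0 ≤ u) :
    ∏ e, (1 - (P e : ℝ) * (1 - Real.exp (-t * d e)))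
      - ∏ e, (1 - (P e : ℝ) * (1 - Real.exp (-(t - u) * d e)))
      - Real.exp (-(u * a)) * ∏ e, (1 - (P e : ℝ) * (1 - Real.exp (-(t + u) * d e)))
      ≤ Real.exp (t * a) * (bernoulliPi P).real {H | linStat d H < 0} := by
  simp only [← integral_exp_linStat]
  rw [← integral_indicator_one (measurableSet_bool_pi _), ← integral_const_mul,
    ← integral_const_mul, sub_le_iff_le_add, sub_le_iff_le_add,
    ← integral_add (integrable_bernoulliPi P _) (integrable_bernoulliPi P _),
    ← integral_add (integrable_bernoulliPi P _) (integrable_bernoulliPi P _)]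
  refine integral_mono (integrable_bernoulliPi P _) (integrable_bernoulliPi P _) fun H => ?_
  simp only [linStat_smul, Set.indicator, Set.mem_ofPred_eq, Pi.one_apply]
  set D := linStat d H
  have e1 := Real.exp_pos (t * a)
  have e2 := Real.exp_pos (-(u * a))
  have e3 := Real.exp_pos (-(t + u) * D)
  have e4 := Real.exp_pos (-(t - u) * D)
  have e5 := mul_pos e2 e3
  by_cases h0 : 0 ≤ D
  · have : Real.exp (-t * D) ≤ Real.exp (-(t - u) * D) :=
      Real.exp_le_exp.2 (by nlinarith [mul_nonneg hu h0])
    simp only [not_lt.2 h0, if_false, mul_zero]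
    linarith
  · push Not at h0
    simp only [h0, if_true, mul_one]
    by_cases h1 : D < -a
    · have : Real.exp (-t * D) ≤ Real.exp (-(u * a)) * Real.exp (-(t + u) * D) := by
        rw [← Real.exp_add]
        exact Real.exp_le_exp.2 (by nlinarith [mul_nonneg hu (by linarith : 0 ≤ -a - D)])
      linarith
    · push Not at h1
      have : Real.exp (-t * D) ≤ Real.exp (t * a) :=
        Real.exp_le_exp.2 (by nlinarith [mul_nonneg ht (by linarith : 0 ≤ D + a)])
      linarith

/-- Events that depend on disjoint sets of coordinates are independent. -/
theorem measure_inter_of_dependsOn (P : ι → I) {E F : Set (ι → Bool)} {J K : Finset ι}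
    (hE : DependsOn (fun H => H ∈ E) (J : Set ι)) (hF : DependsOn (fun H => H ∈ F) (K : Set ι))
    (hJK : Disjoint J K) :
    (bernoulliPi P).real (E ∩ F) = (bernoulliPi P).real E * (bernoulliPi P).real F := by
  have hind : iIndepFun (fun (e : ι) (H : ι → Bool) => H e) (bernoulliPi P) :=
    iIndepFun_pi (X := fun _ b => b) fun _ => by fun_prop
  have h2 := hind.indepFun_finset J K hJK (fun e => measurable_pi_apply e)
  have key : ∀ {E : Set (ι → Bool)} {J : Finset ι},
      DependsOn (fun H => H ∈ E) (J : Set ι) → E = (fun H (e : J) => H e) ⁻¹'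
        ((fun H (e : J) => H e) '' E) := by
    intro E J hE
    refine Set.Subset.antisymm (Set.subset_preimage_image _ _) ?_
    rintro H ⟨H', hH', hHH⟩
    refine (hE (x := H') (y := H) fun e he => ?_).mp hH'
    exact congrFun hHH ⟨e, he⟩
  have h3 := h2.measure_inter_preimage_eq_mul _ _
    (measurableSet_bool_pi ((fun H (e : J) => H e) '' E))
    (measurableSet_bool_pi ((fun H (e : K) => H e) '' F))
  rw [← key hE, ← key hF] at h3
  simp only [measureReal_def, h3, ENNReal.toReal_mul]

theorem measure_biInter_of_dependsOn {V : Type*} [DecidableEq V] (P : ι → I) (T : Finset V)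
    (E : V → Set (ι → Bool)) (J : V → Finset ι)
    (hE : ∀ i, DependsOn (fun H => H ∈ E i) (J i : Set ι))
    (hJ : (T : Set V).PairwiseDisjoint J) :
    (bernoulliPi P).real (⋂ i ∈ T, E i) = ∏ i ∈ T, (bernoulliPi P).real (E i) := by
  classical
  induction T using Finset.induction_on with
  | empty => simp
  | insert a T ha ih =>
    rw [Finset.set_biInter_insert, Finset.prod_insert ha,
      ← ih (hJ.subset (by simp))]
    refine measure_inter_of_dependsOn P (K := T.biUnion J) (hE a) ?_ ?_
    · intro H H' hH
      simp only [Set.mem_iInter]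
      refine propext (forall₂_congr fun i hi => ?_)
      refine Eq.to_iff (hE i fun e he => hH e ?_)
      simp only [Finset.coe_biUnion, Set.mem_iUnion]
      exact ⟨i, hi, he⟩
    · rw [Finset.disjoint_biUnion_right]
      intro i hi
      exact hJ (by simp) (by simp [hi]) (by rintro rfl; exact ha hi)

/-- If the events `E i` depend on disjoint blocks and each has probability at least `ρ`, and the
`B i` are events of probability at most `b` that depend on further coordinates, then with
probability at least `1 - exp (-ρ * #T) - b` some `E i` occurs without `B i`: the choice of an
index `i` with `E i` is independent of all the `B i`. -/
theorem measure_forall_not_le {V : Type*} [DecidableEq V] (P : ι → I)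
    (T : Finset V) (E B : V → Set (ι → Bool)) (J : V → Finset ι) (K : Finset ι)
    (hE : ∀ i, DependsOn (fun H => H ∈ E i) (J i : Set ι))
    (hB : ∀ i, DependsOn (fun H => H ∈ B i) (K : Set ι))
    (hJ : (T : Set V).PairwiseDisjoint J) (hJK : ∀ i, Disjoint (J i) K)
    {ρ b : ℝ} (hρ : ∀ i ∈ T, ρ ≤ (bernoulliPi P).real (E i)) (hb0 : 0 ≤ b)
    (hb : ∀ i ∈ T, (bernoulliPi P).real (B i) ≤ b) :
    (bernoulliPi P).real {H | ∀ i ∈ T, H ∈ E i → H ∈ B i} ≤ Real.exp (-(ρ * T.card)) + b := by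
  classical
  have h1 : (bernoulliPi P).real (⋂ i ∈ T, (E i)ᶜ) ≤ Real.exp (-(ρ * T.card)) := by
    rw [measure_biInter_of_dependsOn P T (fun i => (E i)ᶜ) J
      (fun i H H' hH => by simp only [Set.mem_compl_iff]; exact congrArg Not (hE i hH)) hJ]
    refine (Finset.prod_le_prod (fun i _ => measureReal_nonneg)
      (g := fun _ => Real.exp (-ρ)) fun i hi => ?_).trans (le_of_eq ?_)
    · rw [probReal_compl_eq_one_sub (measurableSet_bool_pi _)]
      have := Real.add_one_le_exp (-ρ)
      linarith [hρ i hi]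
    · rw [Finset.prod_const, ← Real.exp_nat_mul]; ring_nf
  -- the chosen index, as a function of the set of indices `i` with `E i`
  let c : (V → Prop) → Option V := fun p => if h : ∃ i ∈ T, p i then some h.choose else none
  have hc : ∀ p i, c p = some i → i ∈ T ∧ p i := by
    intro p i h
    by_cases hp : ∃ i ∈ T, p i
    · simp only [c, hp, dite_true, Option.some.injEq] at h
      rw [← h]; exact hp.choose_spec
    · simp [c, hp] at h
  have hc' : ∀ p, (∃ i ∈ T, p i) → ∃ i, c p = some i := fun p hp => by simp [c, hp]
  let F : V → Set (ι → Bool) := fun i => {H | c (fun j => j ∈ T ∧ H ∈ E j) = some i}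
  have hF : ∀ i, DependsOn (fun H => H ∈ F i) (T.biUnion J : Set ι) := by
    intro i H H' hH
    simp only [F, Set.mem_ofPred_eq]
    congr 2
    ext j
    refine and_congr_right fun hj => Eq.to_iff (hE j fun e he => hH e ?_)
    simp only [Finset.coe_biUnion, Set.mem_iUnion]
    exact ⟨j, hj, he⟩
  have hsub : {H | ∀ i ∈ T, H ∈ E i → H ∈ B i} ⊆ (⋂ i ∈ T, (E i)ᶜ) ∪ ⋃ i ∈ T, F i ∩ B i := by
    intro H hH
    by_cases h : ∃ i ∈ T, H ∈ E i
    · right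
      obtain ⟨i, hi⟩ := hc' (fun j => j ∈ T ∧ H ∈ E j)
        (by obtain ⟨i, a, b⟩ := h; exact ⟨i, a, a, b⟩)
      have h3 := hc _ _ hi
      simp only [Set.mem_iUnion]
      exact ⟨i, h3.1, hi, hH i h3.1 h3.2.2⟩
    · left
      push Not at h
      simpa using h
  have hdis : (bernoulliPi P).real (⋃ i ∈ T, F i) = ∑ i ∈ T, (bernoulliPi P).real (F i) := by
    refine measureReal_biUnion_finset ?_ (fun i _ => measurableSet_bool_pi _)
    intro i _ j _ hij
    refine Set.disjoint_left.2 fun H h1 h2 => hij ?_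
    have := h1.symm.trans h2
    simpa using this
  calc (bernoulliPi P).real {H | ∀ i ∈ T, H ∈ E i → H ∈ B i}
      ≤ (bernoulliPi P).real ((⋂ i ∈ T, (E i)ᶜ) ∪ ⋃ i ∈ T, F i ∩ B i) := measureReal_mono hsub
    _ ≤ (bernoulliPi P).real (⋂ i ∈ T, (E i)ᶜ) + (bernoulliPi P).real (⋃ i ∈ T, F i ∩ B i) :=
        measureReal_union_le _ _
    _ ≤ Real.exp (-(ρ * T.card)) + b := by
        refine add_le_add h1 ((measureReal_biUnion_finset_le _ _).trans ?_)
        calc ∑ i ∈ T, (bernoulliPi P).real (F i ∩ B i)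
            = ∑ i ∈ T, (bernoulliPi P).real (F i) * (bernoulliPi P).real (B i) :=
              Finset.sum_congr rfl fun i _ => measure_inter_of_dependsOn P (hF i) (hB i)
                ((Finset.disjoint_biUnion_left _ _ _).2 fun j _ => hJK j)
          _ ≤ ∑ i ∈ T, (bernoulliPi P).real (F i) * b :=
              Finset.sum_le_sum fun i hi => mul_le_mul_of_nonneg_left (hb i hi) measureReal_nonneg
          _ = (bernoulliPi P).real (⋃ i ∈ T, F i) * b := by rw [hdis, Finset.sum_mul]
          _ ≤ 1 * b := mul_le_mul_of_nonneg_right measureReal_le_one hb0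
          _ = b := one_mul b

/-- The union bound for the event that some edge of `J` is present. -/
theorem measure_exists_mem_le (P : ι → I) (J : Finset ι) :
    (bernoulliPi P).real {H | ∃ e ∈ J, H e = true} ≤ ∑ e ∈ J, (P e : ℝ) := by
  have : {H : ι → Bool | ∃ e ∈ J, H e = true} = ⋃ e ∈ J, {H | H e = true} := by
    ext H; simp
  rw [this]
  refine (measureReal_biUnion_finset_le _ _).trans (Finset.sum_le_sum fun e _ => le_of_eq ?_)
  have h := (measurePreserving_eval (fun e => bernoulliMeasure true false (P e))
    e).measureReal_preimage (s := {true}) (measurableSet_singleton _).nullMeasurableSet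
  rw [bernoulliMeasure_real_apply_of_mem_of_notMem _ (measurableSet_singleton _) (by simp)
    (by simp)] at h
  exact h

end Bernoulli

/-! ### The objective as a sum over hyperedges -/

/-- The sign vector `x` with real values. -/
def sgn {n : ℕ} (x : Labeling n) (i : Fin n) : ℝ := (((x i : ℤˣ) : ℤ) : ℝ)

theorem sgn_mul_self {n : ℕ} (x : Labeling n) (i : Fin n) : sgn x i * sgn x i = 1 := by
  unfold sgn
  rcases Int.units_eq_one_or (x i) with h | h <;> simp [h]

theorem abs_sgn {n : ℕ} (x : Labeling n) (i : Fin n) : |sgn x i| = 1 := by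
  unfold sgn
  rcases Int.units_eq_one_or (x i) with h | h <;> simp [h]

theorem mem_balanced_iff {n : ℕ} (x : Labeling n) : x ∈ balanced n ↔ ∑ i, sgn x i = 0 := by
  simp only [balanced, sgn, Set.mem_ofPred_eq]
  exact_mod_cast Iff.rfl

/-- The sum of the labels of the vertices of `e`. -/
def edgeSum {n : ℕ} (x : Labeling n) (e : Finset (Fin n)) : ℝ := ∑ i ∈ e, sgn x i

theorem abs_edgeSum_le {n : ℕ} (x : Labeling n) (e : Finset (Fin n)) : |edgeSum x e| ≤ e.card := by
  refine (Finset.abs_sum_le_sum_abs _ _).trans (le_of_eq ?_)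
  simp [abs_sgn]

theorem edgeSum_sq_le {n : ℕ} (x : Labeling n) (e : Finset (Fin n)) :
    edgeSum x e ^ 2 ≤ (e.card : ℝ) ^ 2 :=
  sq_le_sq' (abs_le.1 (abs_edgeSum_le x e)).1 (abs_le.1 (abs_edgeSum_le x e)).2

/-- The contribution of the hyperedge `e` to the change of the objective from `x` to `y`. -/
noncomputable def gain {n : ℕ} (x y : Labeling n) (e : Finset (Fin n)) : ℝ :=
  (edgeSum y e ^ 2 - edgeSum x e ^ 2) / 2

theorem abs_gain_le {n : ℕ} (x y : Labeling n) (e : Finset (Fin n)) :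
    |gain x y e| ≤ (e.card : ℝ) ^ 2 / 2 := by
  unfold gain
  rw [abs_le]
  constructor <;>
    linarith [edgeSum_sq_le x e, edgeSum_sq_le y e, sq_nonneg (edgeSum x e),
      sq_nonneg (edgeSum y e)]

theorem sum_sq_eq_diag_add_two_mul {n : ℕ} (z : Fin n → ℝ) :
    (∑ i, z i) ^ 2 = ∑ i, z i ^ 2 + 2 * ∑ i, ∑ j ∈ Finset.Ioi i, z i * z j := by
  have h1 : ∀ i : Fin n, ∑ j, z i * z j
      = z i ^ 2 + (∑ j ∈ Finset.Ioi i, z i * z j + ∑ j ∈ Finset.Iio i, z i * z j) := by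
    intro i
    have hu : (Finset.univ : Finset (Fin n)) = insert i (Finset.Ioi i ∪ Finset.Iio i) := by
      ext j; rcases lt_trichotomy j i with h | h | h <;> simp [h]
    rw [hu, Finset.sum_insert (by simp), Finset.sum_union, sq]
    exact Finset.disjoint_left.2 fun j hj hj' =>
      lt_asymm (Finset.mem_Ioi.1 hj) (Finset.mem_Iio.1 hj')
  have h2 : ∑ i, ∑ j ∈ Finset.Iio i, z i * z j = ∑ i, ∑ j ∈ Finset.Ioi i, z i * z j := by
    rw [Finset.sum_comm' (t' := Finset.univ) (s' := fun j => Finset.Ioi j) (by simp)]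
    exact Finset.sum_congr rfl fun i _ => Finset.sum_congr rfl fun j _ => mul_comm _ _
  rw [sq, Finset.sum_mul_sum, Finset.sum_congr rfl fun i _ => h1 i, Finset.sum_add_distrib,
    Finset.sum_add_distrib, h2]
  ring

theorem edgeSum_sq_eq {n : ℕ} (x : Labeling n) (e : Finset (Fin n)) :
    (edgeSum x e ^ 2 - e.card) / 2
      = ∑ i, ∑ j ∈ Finset.Ioi i, (if i ∈ e ∧ j ∈ e then sgn x i * sgn x j else 0) := by
  have h := sum_sq_eq_diag_add_two_mul fun i => if i ∈ e then sgn x i else 0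
  have h1 : ∑ i, (if i ∈ e then sgn x i else 0) = edgeSum x e := by
    simp [edgeSum]
  have h2 : ∑ i, (if i ∈ e then sgn x i else 0) ^ 2 = e.card := by
    simp [ite_pow, sq, sgn_mul_self]
  rw [h1, h2] at h
  rw [h]
  simp only [ite_mul, mul_ite, mul_zero, zero_mul, ← ite_and, and_comm]
  ring

theorem weight_eq_sum {n k : ℕ} (H : Hypergraph n k) (i j : Fin n) :
    (weight H i j : ℝ) = ∑ e : KSet n k, if H e = true ∧ i ∈ e.1 ∧ j ∈ e.1 then 1 else 0 := by
  rw [weight, Fintype.card_subtype, Finset.sum_boole]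

theorem bisectionObj_eq_linStat {n k : ℕ} (H : Hypergraph n k) (x : Labeling n) :
    (bisectionObj H x : ℝ) = linStat (fun e : KSet n k => (edgeSum x e.1 ^ 2 - k) / 2) H := by
  have h1 : ∀ e : KSet n k, (if H e then (edgeSum x e.1 ^ 2 - k) / 2 else 0)
      = ∑ i, ∑ j ∈ Finset.Ioi i, (if H e = true ∧ i ∈ e.1 ∧ j ∈ e.1 then (1 : ℝ) else 0)
        * sgn x i * sgn x j := by
    intro e
    have := edgeSum_sq_eq x e.1
    rw [e.2] at this
    rw [this]
    by_cases hH : H e <;> simp [hH]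
  simp only [linStat, h1]
  rw [Finset.sum_comm]
  simp only [bisectionObj, Int.cast_sum, Int.cast_mul, Int.cast_natCast]
  refine Finset.sum_congr rfl fun i _ => ?_
  rw [Finset.sum_comm]
  refine Finset.sum_congr rfl fun j _ => ?_
  rw [weight_eq_sum, ← Finset.sum_mul, ← Finset.sum_mul]
  rfl

/-- The change of the objective is a linear statistic of the hyperedge indicators. -/
theorem bisectionObj_sub_eq_linStat {n k : ℕ} (H : Hypergraph n k) (x y : Labeling n) :
    (bisectionObj H y : ℝ) - bisectionObj H x = linStat (fun e : KSet n k => gain x y e.1) H := by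
  rw [bisectionObj_eq_linStat, bisectionObj_eq_linStat, linStat, linStat, linStat,
    ← Finset.sum_sub_distrib]
  refine Finset.sum_congr rfl fun e _ => ?_
  unfold gain
  split_ifs <;> ring

theorem bisectionObj_neg {n k : ℕ} (H : Hypergraph n k) (x : Labeling n) :
    bisectionObj H (-x) = bisectionObj H x := by
  simp [bisectionObj]

theorem neg_mem_balanced {n : ℕ} {x : Labeling n} (hx : x ∈ balanced n) : -x ∈ balanced n := by
  simp only [balanced, Set.mem_ofPred_eq] at hx ⊢
  simp [hx]

/-! ### Flipping the labels of a set of vertices -/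

/-- The labels `x`, reversed on `A`. -/
def flip {n : ℕ} (A : Finset (Fin n)) (x : Labeling n) : Labeling n :=
  fun i => if i ∈ A then -x i else x i

theorem sgn_flip {n : ℕ} (A : Finset (Fin n)) (x : Labeling n) (i : Fin n) :
    sgn (flip A x) i = sgn x i - 2 * (if i ∈ A then sgn x i else 0) := by
  unfold sgn flip
  split_ifs <;> simp
  ring

theorem edgeSum_flip {n : ℕ} (A : Finset (Fin n)) (x : Labeling n) (e : Finset (Fin n)) :
    edgeSum (flip A x) e = edgeSum x e - 2 * edgeSum x (e ∩ A) := by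
  simp only [edgeSum, sgn_flip, Finset.sum_sub_distrib, ← Finset.mul_sum, Finset.sum_ite_mem]

/-- Every labelling is `x`, reversed where it differs from `x`. -/
theorem flip_filter_ne {n : ℕ} (x y : Labeling n) :
    flip (Finset.univ.filter fun i => x i ≠ y i) x = y := by
  ext i
  simp only [flip, Finset.mem_filter, Finset.mem_univ, true_and]
  split_ifs with h
  · rcases Int.units_eq_one_or (x i) with h1 | h1 <;>
      rcases Int.units_eq_one_or (y i) with h2 | h2 <;> simp_all
  · push Not at h; rw [h]

/-- The sum of the labels of the other vertices of `e`, relative to the label of `i ∈ e`. -/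
noncomputable def loc {n : ℕ} (x : Labeling n) (i : Fin n) (e : Finset (Fin n)) : ℝ :=
  sgn x i * edgeSum x e - 1

theorem abs_loc_le {n : ℕ} (x : Labeling n) (i : Fin n) (e : Finset (Fin n)) :
    |loc x i e| ≤ e.card + 1 := by
  refine (abs_sub _ _).trans ?_
  rw [abs_mul, abs_sgn, one_mul, abs_one]
  linarith [abs_edgeSum_le x e]

theorem gain_flip_of_inter_eq_singleton {n : ℕ} {A : Finset (Fin n)} (x : Labeling n)
    {e : Finset (Fin n)} {i : Fin n} (h : e ∩ A = {i}) :
    gain x (flip A x) e = -2 * loc x i e := by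
  have h1 : edgeSum x (e ∩ A) = sgn x i := by rw [h]; simp [edgeSum]
  rw [gain, edgeSum_flip, h1, loc]
  linear_combination 2 * sgn_mul_self x i

theorem gain_flip_of_edgeSum_inter_eq_zero {n : ℕ} {A : Finset (Fin n)} (x : Labeling n)
    {e : Finset (Fin n)} (h : edgeSum x (e ∩ A) = 0) : gain x (flip A x) e = 0 := by
  rw [gain, edgeSum_flip, h]
  ring

/-! ### Counting hyperedges -/

theorem sum_kset {n k : ℕ} (F : Finset (Fin n) → ℝ) :
    ∑ e : KSet n k, F e.1 = ∑ e ∈ Finset.powersetCard k Finset.univ, F e :=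
  (Finset.sum_subtype _ (by simp) F).symm

theorem card_kset_filter {n k : ℕ} (φ : Finset (Fin n) → Prop) [DecidablePred φ] :
    (Finset.univ.filter fun e : KSet n k => φ e.1).card
      = ((Finset.powersetCard k Finset.univ).filter φ).card := by
  have h := sum_kset (n := n) (k := k) fun e => if φ e then 1 else 0
  rw [Finset.sum_boole, Finset.sum_boole] at h
  exact_mod_cast h

theorem card_kset (n k : ℕ) : Fintype.card (KSet n k) = n.choose k := by
  have h := card_kset_filter (n := n) (k := k) fun _ => True
  simp

theorem card_kset_mem {n k : ℕ} (hk : 1 ≤ k) (i : Fin n) :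
    (Finset.univ.filter fun e : KSet n k => i ∈ e.1).card = (n - 1).choose (k - 1) := by
  rw [card_kset_filter fun e => i ∈ e]
  have := Finset.card_filter_powersetCard_subset {i} Finset.univ k (by simp) (by simpa)
  simpa using this

theorem card_powersetCard_pair {n k : ℕ} (hk : 2 ≤ k) (U : Finset (Fin n)) {i j : Fin n}
    (hi : i ∈ U) (hj : j ∈ U) (hij : i ≠ j) :
    ((Finset.powersetCard k U).filter fun e => i ∈ e ∧ j ∈ e).card
      = (U.card - 2).choose (k - 2) := by
  have h2 : ({i, j} : Finset (Fin n)).card = 2 := Finset.card_pair hij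
  have := Finset.card_filter_powersetCard_subset {i, j} U k
    (by intro a ha; simp at ha; rcases ha with rfl | rfl <;> assumption) (by omega)
  rw [h2] at this
  rw [← this]
  congr 1
  ext e
  simp [Finset.insert_subset_iff]

/-- The number of hyperedges at `i` that meet `A` in two or more vertices. -/
theorem card_kset_mem_two_le_inter {n k : ℕ} (hk : 2 ≤ k) (A : Finset (Fin n)) (i : Fin n) :
    (Finset.univ.filter fun e : KSet n k => i ∈ e.1 ∧ 2 ≤ (e.1 ∩ A).card).card
      ≤ A.card * (n - 2).choose (k - 2) := by
  rw [card_kset_filter fun e => i ∈ e ∧ 2 ≤ (e ∩ A).card]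
  refine (Finset.card_le_card (t := (A.erase i).biUnion fun j =>
    (Finset.powersetCard k Finset.univ).filter fun e => i ∈ e ∧ j ∈ e) ?_).trans ?_
  · intro e he
    simp only [Finset.mem_filter] at he
    obtain ⟨j, hj, hji⟩ := Finset.exists_mem_ne (by omega : 1 < (e ∩ A).card) i
    simp only [Finset.mem_biUnion, Finset.mem_filter, Finset.mem_erase]
    rw [Finset.mem_inter] at hj
    exact ⟨j, ⟨hji, hj.2⟩, he.1, he.2.1, hj.1⟩
  · refine (Finset.card_biUnion_le_card_mul _ _ ((n - 2).choose (k - 2)) fun j hj => ?_).trans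
      (Nat.mul_le_mul_right _ (Finset.card_le_card (Finset.erase_subset _ _)))
    rw [card_powersetCard_pair hk _ (by simp) (by simp) (Finset.ne_of_mem_erase hj).symm]
    simp

/-- Double counting of pairs: replacing `x` by `y` changes `∑ (edgeSum e) ^ 2` over the `k`-subsets
`e` of `U` by a multiple of the change of `(edgeSum U) ^ 2`. -/
theorem sum_powersetCard_edgeSum_sq_sub {n k : ℕ} (hk : 2 ≤ k) (U : Finset (Fin n))
    (x y : Labeling n) :
    ∑ e ∈ Finset.powersetCard k U, (edgeSum x e ^ 2 - edgeSum y e ^ 2)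
      = (U.card - 2).choose (k - 2) * (edgeSum x U ^ 2 - edgeSum y U ^ 2) := by
  have h0 : ∀ e : Finset (Fin n), edgeSum x e ^ 2 - edgeSum y e ^ 2
      = ∑ i ∈ e, ∑ j ∈ e, (sgn x i * sgn x j - sgn y i * sgn y j) := by
    intro e
    simp only [edgeSum, sq, Finset.sum_mul_sum, Finset.sum_sub_distrib]
  have h1 : ∀ e ∈ Finset.powersetCard k U, edgeSum x e ^ 2 - edgeSum y e ^ 2
      = ∑ i ∈ U, ∑ j ∈ U,
        (if i ∈ e ∧ j ∈ e then 1 else 0) * (sgn x i * sgn x j - sgn y i * sgn y j) := by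
    intro e he
    have hU : U ∩ e = e := Finset.inter_eq_right.2 (Finset.mem_powersetCard.1 he).1
    rw [h0]
    simp only [ite_mul, one_mul, zero_mul, ite_and]
    simp [Finset.sum_ite_mem, hU]
  rw [Finset.sum_congr rfl h1, Finset.sum_comm, h0, Finset.mul_sum]
  refine Finset.sum_congr rfl fun i hi => ?_
  rw [Finset.sum_comm, Finset.mul_sum]
  refine Finset.sum_congr rfl fun j hj => ?_
  rw [← Finset.sum_mul, Finset.sum_boole]
  by_cases hij : i = j
  · subst hij
    simp [sgn_mul_self]
  · rw [card_powersetCard_pair hk U hi hj hij]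

/-! ### The hyperedges at a vertex -/

/-- The number of vertices of `e` whose label differs from that of `i`. -/
def opp {n : ℕ} (x : Labeling n) (i : Fin n) (e : Finset (Fin n)) : ℕ :=
  (e.filter fun j => x j ≠ x i).card

theorem sgn_mul_sgn {n : ℕ} (x : Labeling n) (i j : Fin n) :
    sgn x i * sgn x j = 1 - 2 * (if x j ≠ x i then 1 else 0) := by
  unfold sgn
  rcases Int.units_eq_one_or (x i) with h1 | h1 <;>
    rcases Int.units_eq_one_or (x j) with h2 | h2 <;> norm_num [h1, h2]

theorem loc_eq {n : ℕ} (x : Labeling n) (i : Fin n) (e : Finset (Fin n)) :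
    loc x i e = (e.card : ℝ) - 1 - 2 * opp x i e := by
  simp only [loc, edgeSum, Finset.mul_sum, sgn_mul_sgn, Finset.sum_sub_distrib, opp]
  rw [← Finset.mul_sum, Finset.sum_boole]
  simp
  ring

theorem inCluster_iff_opp_eq_zero {n : ℕ} (x : Labeling n) {i : Fin n} {e : Finset (Fin n)}
    (hi : i ∈ e) : InCluster x e ↔ opp x i e = 0 := by
  rw [opp, Finset.card_eq_zero, Finset.filter_eq_empty_iff]
  constructor
  · exact fun h j hj => not_not.2 (h j hj i hi)
  · intro h a ha b hb
    rw [not_not.1 (h ha), not_not.1 (h hb)]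

theorem card_filter_eq_of_balanced {m : ℕ} {x : Labeling (2 * m)} (hx : x ∈ balanced (2 * m))
    (i : Fin (2 * m)) :
    (Finset.univ.filter fun j => x j = x i).card = m ∧
      (Finset.univ.filter fun j => x j ≠ x i).card = m := by
  have h1 : (Finset.univ.filter fun j => x j = x i).card
      + (Finset.univ.filter fun j => x j ≠ x i).card = 2 * m := by
    rw [Finset.card_filter_add_card_filter_not]; simp
  have h2 : ∑ j, sgn x i * sgn x j = 0 := by
    rw [← Finset.mul_sum, (mem_balanced_iff x).1 hx, mul_zero]
  simp only [sgn_mul_sgn, Finset.sum_sub_distrib] at h2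
  rw [← Finset.mul_sum, Finset.sum_boole] at h2
  simp only [Finset.sum_const, Finset.card_univ, Fintype.card_fin, nsmul_eq_mul, mul_one] at h2
  have h3 : 2 * m = 2 * (Finset.univ.filter fun j => x j ≠ x i).card := by
    have : ((2 * m : ℕ) : ℝ) = 2 * ((Finset.univ.filter fun j => x j ≠ x i).card : ℝ) := by
      linarith
    exact_mod_cast this
  omega

/-- The number of hyperedges at `i` with `r` vertices whose label differs from that of `i`. -/
theorem card_kset_mem_opp_eq {m k r : ℕ} (hr : r + 1 ≤ k) {x : Labeling (2 * m)}
    (hx : x ∈ balanced (2 * m)) (i : Fin (2 * m)) :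
    (Finset.univ.filter fun e : KSet (2 * m) k => i ∈ e.1 ∧ opp x i e.1 = r).card
      = (m - 1).choose (k - 1 - r) * m.choose r := by
  rw [card_kset_filter fun e => i ∈ e ∧ opp x i e = r]
  obtain ⟨h1, h2⟩ := card_filter_eq_of_balanced hx i
  have hP : ((Finset.univ.filter fun j => x j = x i).erase i).card = m - 1 := by
    rw [Finset.card_erase_of_mem (by simp), h1]
  have hN : m.choose r = (Finset.powersetCard r (Finset.univ.filter fun j => x j ≠ x i)).card := by
    rw [Finset.card_powersetCard, h2]
  rw [hN, ← hP, ← Finset.card_powersetCard (k - 1 - r), ← Finset.card_product]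
  refine Finset.card_bij'
    (fun e _ => ((e.filter fun j => x j = x i).erase i, e.filter fun j => x j ≠ x i))
    (fun ab _ => insert i (ab.1 ∪ ab.2)) ?_ ?_ ?_ ?_
  · intro e he
    rw [Finset.mem_filter, Finset.mem_powersetCard] at he
    obtain ⟨⟨-, hek⟩, hie, her⟩ := he
    simp only [opp, ne_eq] at her
    simp only [Finset.mem_product, Finset.mem_powersetCard]
    refine ⟨⟨Finset.erase_subset_erase _ (Finset.filter_subset_filter _ (Finset.subset_univ _)),
      ?_⟩, Finset.filter_subset_filter _ (Finset.subset_univ _), her⟩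
    rw [Finset.card_erase_of_mem (by simp [hie])]
    have := Finset.card_filter_add_card_filter_not (s := e) (fun j => x j = x i)
    omega
  · intro ab hab
    simp only [Finset.mem_product, Finset.mem_powersetCard] at hab
    obtain ⟨⟨ha, ha'⟩, hb, hb'⟩ := hab
    have hA : ∀ j ∈ ab.1, j ≠ i ∧ x j = x i := fun j hj => by simpa using ha hj
    have hB : ∀ j ∈ ab.2, x j ≠ x i := fun j hj => by simpa using hb hj
    have hdis : Disjoint ab.1 ab.2 := Finset.disjoint_left.2 fun j h h' => hB j h' (hA j h).2
    have hi : i ∉ ab.1 ∪ ab.2 := by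
      rw [Finset.mem_union]
      rintro (h | h)
      · exact (hA i h).1 rfl
      · exact hB i h rfl
    simp only [Finset.mem_filter, Finset.mem_powersetCard, Finset.subset_univ, true_and,
      Finset.mem_insert, true_or]
    refine ⟨?_, ?_⟩
    · rw [Finset.card_insert_of_notMem hi, Finset.card_union_of_disjoint hdis]
      omega
    · rw [opp, ← hb']
      congr 1
      ext j
      simp only [Finset.mem_filter, Finset.mem_insert, Finset.mem_union]
      constructor
      · rintro ⟨rfl | h | h, h'⟩
        · exact absurd rfl h'
        · exact absurd (hA j h).2 h'
        · exact h
      · exact fun h => ⟨.inr (.inr h), hB j h⟩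
  · intro e he
    simp only [Finset.mem_filter] at he
    ext j
    simp only [Finset.mem_insert, Finset.mem_union, Finset.mem_erase, Finset.mem_filter]
    by_cases hj : j = i
    · simp [hj, he.2.1]
    · by_cases hx : x j = x i <;> simp [hj, hx]
  · intro ab hab
    simp only [Finset.mem_product, Finset.mem_powersetCard] at hab
    obtain ⟨⟨ha, ha'⟩, hb, hb'⟩ := hab
    have hA : ∀ j ∈ ab.1, j ≠ i ∧ x j = x i := fun j hj => by simpa using ha hj
    have hB : ∀ j ∈ ab.2, x j ≠ x i := fun j hj => by simpa using hb hj
    refine Prod.ext ?_ ?_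
    · ext j
      simp only [Finset.mem_insert, Finset.mem_union, Finset.mem_erase, Finset.mem_filter]
      constructor
      · rintro ⟨h1, h2 | h2 | h2, h3⟩
        · exact absurd h2 h1
        · exact h2
        · exact absurd h3 (hB j h2)
      · exact fun h => ⟨(hA j h).1, .inr (.inl h), (hA j h).2⟩
    · ext j
      simp only [Finset.mem_insert, Finset.mem_union, Finset.mem_filter]
      constructor
      · rintro ⟨rfl | h2 | h2, h3⟩
        · exact absurd rfl h3
        · exact absurd (hA j h2).2 h3
        · exact h2
      · exact fun h => ⟨.inr (.inr h), hB j h⟩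

/-- The exponent `∑ p_e (1 - exp (-t s_e))` of the hyperedges `e` at a vertex, where `s_e` is the
sum of the relative labels of the other vertices of `e`, for `2 m` vertices with balanced labels. -/
noncomputable def degExp (m k : ℕ) (p q : I) (t : ℝ) : ℝ :=
  ∑ r ∈ Finset.range k, ((m - 1).choose (k - 1 - r) * m.choose r : ℕ) *
    ((if r = 0 then (p : ℝ) else q) * (1 - Real.exp (-t * ((k : ℝ) - 1 - 2 * r))))

/-- The exponent at a vertex depends on the labels only through their balance. -/
theorem sum_mem_exp_loc_eq_degExp {m k : ℕ} {p q : I} {x : Labeling (2 * m)}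
    (hx : x ∈ balanced (2 * m)) (i : Fin (2 * m)) (t : ℝ) :
    ∑ e : KSet (2 * m) k, (if i ∈ e.1 then
        (edgeProb p q x e.1 : ℝ) * (1 - Real.exp (-t * loc x i e.1)) else 0)
      = degExp m k p q t := by
  rw [← Finset.sum_filter, ← Finset.sum_fiberwise_of_maps_to (t := Finset.range k)
    (g := fun e : KSet (2 * m) k => opp x i e.1)]
  · refine Finset.sum_congr rfl fun r hr => ?_
    rw [← card_kset_mem_opp_eq (Finset.mem_range.1 hr) hx i, ← nsmul_eq_mul, ← Finset.sum_const,
      Finset.filter_filter]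
    refine Finset.sum_congr rfl fun e he => ?_
    simp only [Finset.mem_filter, Finset.mem_univ, true_and] at he
    rw [loc_eq, he.2, e.2, edgeProb]
    simp only [inCluster_iff_opp_eq_zero x he.1, he.2]
    split_ifs <;> rfl
  · intro e he
    simp only [Finset.mem_filter, Finset.mem_univ, true_and] at he
    rw [Finset.mem_range]
    exact (Finset.card_lt_card (Finset.filter_ssubset.2 ⟨i, he, by simp⟩)).trans_eq e.2

theorem edgeProb_le {n : ℕ} {p q : I} (hqp : (q : ℝ) ≤ p) (x : Labeling n)
    (e : Finset (Fin n)) : (edgeProb p q x e : ℝ) ≤ p := by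
  unfold edgeProb
  split_ifs
  · exact le_rfl
  · exact hqp

theorem abs_one_sub_exp_le (z : ℝ) : |1 - Real.exp z| ≤ Real.exp |z| := by
  have h1 := Real.exp_le_exp.2 (le_abs_self z)
  have h2 := Real.one_le_exp (abs_nonneg z)
  have h3 := Real.exp_pos z
  rw [abs_le]
  constructor <;> linarith

theorem hypergraphLaw_eq {n k : ℕ} (p q : I) (x : Labeling n) :
    hypergraphLaw n k p q x = bernoulliPi fun e : KSet n k => edgeProb p q x e.1 := rfl

/-! ### Chernoff bounds for a competing bisection -/

theorem measure_flip_le {n k : ℕ} (p q : I) (x : Labeling n) (A : Finset (Fin n)) {θ : ℝ}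
    (hθ : 0 ≤ θ) :
    (hypergraphLaw n k p q x).real {H | bisectionObj H x ≤ bisectionObj H (flip A x)}
      ≤ Real.exp (-∑ e : KSet n k,
          (edgeProb p q x e.1 : ℝ) * (1 - Real.exp (θ * gain x (flip A x) e.1))) := by
  refine le_trans ?_ (measure_linStat_nonneg_le _ _)
  rw [hypergraphLaw_eq]
  refine measureReal_mono fun H hH => ?_
  simp only [Set.mem_ofPred_eq] at hH ⊢
  rw [linStat_smul, ← bisectionObj_sub_eq_linStat]
  exact mul_nonneg hθ (sub_nonneg.2 (by exact_mod_cast hH))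

/-- Chernoff's bound for the competitor that differs from `x` on a small set `A`: up to the
hyperedges with two or more vertices in `A`, the vertices of `A` contribute independently. -/
theorem measure_flip_le_small {m k : ℕ} (hk : 2 ≤ k) {p q : I} (hqp : (q : ℝ) ≤ p)
    {x : Labeling (2 * m)} (hx : x ∈ balanced (2 * m)) (A : Finset (Fin (2 * m))) {t : ℝ}
    (ht : 0 ≤ t) :
    (hypergraphLaw (2 * m) k p q x).real {H | bisectionObj H x ≤ bisectionObj H (flip A x)}
      ≤ Real.exp (-(A.card * (degExp m k p q t - p * (1 + Real.exp (t * (k : ℝ) ^ 2)) *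
          (A.card * (2 * m - 2).choose (k - 2) : ℕ)))) := by
  refine (measure_flip_le p q x A (θ := t / 2) (by positivity)).trans (Real.exp_le_exp.2 ?_)
  rw [neg_le_neg_iff]
  set K := 1 + Real.exp (t * (k : ℝ) ^ 2)
  have hK : 0 ≤ K := by positivity
  have hp0 : 0 ≤ (p : ℝ) := p.2.1
  have key : ∀ e : KSet (2 * m) k,
      ∑ i ∈ A, (if i ∈ e.1 then (edgeProb p q x e.1 : ℝ) * (1 - Real.exp (-t * loc x i e.1)) else 0)
        - p * K * ∑ i ∈ A, (if i ∈ e.1 ∧ 2 ≤ (e.1 ∩ A).card then 1 else 0)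
      ≤ (edgeProb p q x e.1 : ℝ) * (1 - Real.exp (t / 2 * gain x (flip A x) e.1)) := by
    intro e
    have hpe0 : 0 ≤ (edgeProb p q x e.1 : ℝ) := (edgeProb p q x e.1).2.1
    have hpe := edgeProb_le hqp x e.1
    rw [← Finset.sum_filter, Finset.filter_mem_eq_inter, Finset.inter_comm]
    rcases Nat.lt_or_ge (e.1 ∩ A).card 2 with h | h
    · have h2 : ∑ i ∈ A, (if i ∈ e.1 ∧ 2 ≤ (e.1 ∩ A).card then (1 : ℝ) else 0) = 0 :=
        Finset.sum_eq_zero fun i _ => if_neg fun h' => by omega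
      rw [h2, mul_zero, sub_zero]
      rcases Nat.eq_zero_or_pos (e.1 ∩ A).card with h0 | h0
      · rw [Finset.card_eq_zero] at h0
        rw [gain_flip_of_edgeSum_inter_eq_zero x (by simp [h0, edgeSum])]
        simp [h0]
      · obtain ⟨i, hi⟩ := Finset.card_eq_one.1 (by omega : (e.1 ∩ A).card = 1)
        rw [hi, Finset.sum_singleton, gain_flip_of_inter_eq_singleton x hi]
        refine le_of_eq ?_
        ring_nf
    · have h2 : ∑ i ∈ A, (if i ∈ e.1 ∧ 2 ≤ (e.1 ∩ A).card then (1 : ℝ) else 0)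
          = (e.1 ∩ A).card := by
        simp only [h, and_true]
        rw [← Finset.sum_filter, Finset.filter_mem_eq_inter, Finset.inter_comm]
        simp
      have h3 : ∑ i ∈ e.1 ∩ A, (edgeProb p q x e.1 : ℝ) * (1 - Real.exp (-t * loc x i e.1))
          ≤ p * (e.1 ∩ A).card := by
        refine (Finset.sum_le_card_nsmul _ _ (p : ℝ) fun i _ => ?_).trans (by
          rw [nsmul_eq_mul, mul_comm])
        have := Real.exp_pos (-t * loc x i e.1)
        nlinarith
      have h4 : Real.exp (t / 2 * gain x (flip A x) e.1) ≤ Real.exp (t * (k : ℝ) ^ 2) := by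
        refine Real.exp_le_exp.2 ?_
        have := (abs_le.1 (abs_gain_le x (flip A x) e.1)).2
        rw [e.2] at this
        nlinarith [mul_le_mul_of_nonneg_left this ht, mul_nonneg ht (sq_nonneg (k : ℝ))]
      have h5 : (1 : ℝ) ≤ (e.1 ∩ A).card := by exact_mod_cast (by omega)
      have h6 := Real.exp_pos (t * (k : ℝ) ^ 2)
      have h7 : (edgeProb p q x e.1 : ℝ) * Real.exp (t / 2 * gain x (flip A x) e.1)
          ≤ p * Real.exp (t * (k : ℝ) ^ 2) :=
        mul_le_mul hpe h4 (Real.exp_pos _).le hp0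
      have h8 : p * Real.exp (t * (k : ℝ) ^ 2) * 1
          ≤ p * Real.exp (t * (k : ℝ) ^ 2) * (e.1 ∩ A).card :=
        mul_le_mul_of_nonneg_left h5 (by positivity)
      rw [h2]
      simp only [K]
      nlinarith
  refine le_trans ?_ (Finset.sum_le_sum fun e _ => key e)
  rw [Finset.sum_sub_distrib, ← Finset.mul_sum, Finset.sum_comm,
    Finset.sum_comm (t := A)]
  simp only [sum_mem_exp_loc_eq_degExp hx, Finset.sum_const, nsmul_eq_mul]
  have h9 : ∑ i ∈ A, ∑ e : KSet (2 * m) k,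
      (if i ∈ e.1 ∧ 2 ≤ (e.1 ∩ A).card then (1 : ℝ) else 0)
      ≤ A.card * (A.card * (2 * m - 2).choose (k - 2) : ℕ) := by
    rw [← nsmul_eq_mul]
    refine Finset.sum_le_card_nsmul _ _ _ fun i _ => ?_
    rw [Finset.sum_boole]
    exact_mod_cast card_kset_mem_two_le_inter hk A i
  nlinarith [mul_le_mul_of_nonneg_left h9 (mul_nonneg hp0 hK)]

/-- Chernoff's bound for the competitor that differs from `x` on a large set `A`. The sum of
`(edgeSum e) ^ 2` over all `e` is the same for all balanced labels, so the mean of the gain only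
sees the excess `p - q` of the hyperedges inside the two clusters. -/
theorem measure_flip_le_large {m k : ℕ} (hk : 2 ≤ k) {p q : I} (hqp : (q : ℝ) ≤ p)
    {x : Labeling (2 * m)} (hx : x ∈ balanced (2 * m)) (A : Finset (Fin (2 * m)))
    (hy : flip A x ∈ balanced (2 * m)) {θ : ℝ} (hθ : 0 ≤ θ) (hθk : θ * (k : ℝ) ^ 2 ≤ 1) :
    (hypergraphLaw (2 * m) k p q x).real {H | bisectionObj H x ≤ bisectionObj H (flip A x)}
      ≤ Real.exp (-(θ * ((p - q) / 2 * ((m - 2).choose (k - 2) *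
          ((m : ℝ) ^ 2 - (m - A.card) ^ 2)))
        - θ ^ 2 * ((k : ℝ) ^ 4 * (p * (2 * m).choose k)))) := by
  refine (measure_flip_le p q x A hθ).trans (Real.exp_le_exp.2 ?_)
  rw [neg_le_neg_iff]
  set y := flip A x with hy_def
  have hp0 : 0 ≤ (p : ℝ) := p.2.1
  -- second order expansion of the exponential
  have h1 : ∀ e : KSet (2 * m) k, -θ * ((edgeProb p q x e.1 : ℝ) * gain x y e.1)
      - θ ^ 2 * ((k : ℝ) ^ 4 * p)
      ≤ (edgeProb p q x e.1 : ℝ) * (1 - Real.exp (θ * gain x y e.1)) := by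
    intro e
    have hg := abs_gain_le x y e.1
    rw [e.2] at hg
    have hk0 := sq_nonneg (k : ℝ)
    have hg' : |gain x y e.1| ≤ (k : ℝ) ^ 2 := by linarith
    have habs : |θ * gain x y e.1| ≤ 1 := by
      rw [abs_mul, abs_of_nonneg hθ]
      exact (mul_le_mul_of_nonneg_left hg' hθ).trans hθk
    have h2 := (abs_le.1 (Real.abs_exp_sub_one_sub_id_le habs)).2
    have hsq : gain x y e.1 ^ 2 ≤ (k : ℝ) ^ 4 := by
      calc gain x y e.1 ^ 2 = |gain x y e.1| ^ 2 := (sq_abs _).symm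
        _ ≤ ((k : ℝ) ^ 2) ^ 2 := pow_le_pow_left₀ (abs_nonneg _) hg' 2
        _ = (k : ℝ) ^ 4 := by ring
    have hpe0 : 0 ≤ (edgeProb p q x e.1 : ℝ) := (edgeProb p q x e.1).2.1
    have hpe := edgeProb_le hqp x e.1
    have h3 := mul_le_mul_of_nonneg_left h2 hpe0
    have h4 : (edgeProb p q x e.1 : ℝ) * (θ * gain x y e.1) ^ 2
        ≤ p * (θ ^ 2 * (k : ℝ) ^ 4) := by
      rw [mul_pow]
      exact mul_le_mul hpe (mul_le_mul_of_nonneg_left hsq (sq_nonneg θ)) (by positivity) hp0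
    nlinarith
  refine le_trans ?_ (Finset.sum_le_sum fun e _ => h1 e)
  rw [Finset.sum_sub_distrib, ← Finset.mul_sum, Finset.sum_const, Finset.card_univ, card_kset,
    nsmul_eq_mul]
  -- the gains of all hyperedges add up to zero
  have h5 : ∑ e : KSet (2 * m) k, gain x y e.1 = 0 := by
    rw [sum_kset]
    have := sum_powersetCard_edgeSum_sq_sub hk Finset.univ x y
    rw [show edgeSum x Finset.univ = 0 from (mem_balanced_iff x).1 hx,
      show edgeSum y Finset.univ = 0 from (mem_balanced_iff y).1 hy, sub_self, mul_zero] at this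
    calc ∑ e ∈ Finset.powersetCard k Finset.univ, gain x y e
        = -(1 / 2) * ∑ e ∈ Finset.powersetCard k Finset.univ,
            (edgeSum x e ^ 2 - edgeSum y e ^ 2) := by
          rw [Finset.mul_sum]; exact Finset.sum_congr rfl fun e _ => by unfold gain; ring
      _ = 0 := by rw [this, mul_zero]
  rcases Nat.eq_zero_or_pos m with rfl | hm
  · have : ∀ e : KSet (2 * 0) k, False := fun e => by
      have := (Finset.card_le_univ e.1).trans_eq (Fintype.card_fin _)
      have := e.2
      omega
    have hA : A.card = 0 := by
      have := (Finset.card_le_univ A).trans_eq (Fintype.card_fin _)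
      omega
    have h0 : ∑ e : KSet (2 * 0) k, (edgeProb p q x e.1 : ℝ) * gain x y e.1 = 0 :=
      Finset.sum_eq_zero fun e _ => (this e).elim
    rw [h0, hA]
    simp only [Nat.cast_zero, sub_self, mul_zero, zero_sub, neg_le_neg_iff]
    exact le_of_eq (by ring)
  -- the cluster of the first vertex
  let i₀ : Fin (2 * m) := ⟨0, by omega⟩
  set U := Finset.univ.filter fun j => x j = x i₀
  have hU : U.card = m := (card_filter_eq_of_balanced hx i₀).1
  have hUsgn : ∀ j, sgn x i₀ * sgn x j = 2 * (if j ∈ U then 1 else 0) - 1 := by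
    intro j
    rw [sgn_mul_sgn]
    by_cases h : x j = x i₀ <;> norm_num [U, h]
  have hEU : ∀ z : Labeling (2 * m), edgeSum z U ^ 2 = (∑ j ∈ U, sgn x i₀ * sgn z j) ^ 2 := by
    intro z
    rw [← Finset.mul_sum, mul_pow, sq (sgn x i₀), sgn_mul_self, one_mul]; rfl
  have hxU : edgeSum x U ^ 2 = (m : ℝ) ^ 2 := by
    rw [hEU, Finset.sum_congr rfl fun j hj => by rw [hUsgn j, if_pos hj]]
    norm_num [hU]
  have hAU : 2 * ((A ∩ U).card : ℝ) = A.card := by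
    have h6 := edgeSum_flip A x Finset.univ
    rw [show edgeSum x Finset.univ = 0 from (mem_balanced_iff x).1 hx,
      show edgeSum (flip A x) Finset.univ = 0 from (mem_balanced_iff y).1 hy,
      Finset.univ_inter] at h6
    have h7 : ∑ j ∈ A, sgn x i₀ * sgn x j = 0 := by
      rw [← Finset.mul_sum]
      have : ∑ j ∈ A, sgn x j = edgeSum x A := rfl
      rw [this, show edgeSum x A = 0 by linarith, mul_zero]
    simp only [hUsgn, Finset.sum_sub_distrib] at h7
    rw [← Finset.mul_sum, Finset.sum_boole, Finset.filter_mem_eq_inter] at h7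
    simp only [Finset.sum_const, nsmul_eq_mul, mul_one] at h7
    linarith
  have hyU : edgeSum y U ^ 2 = ((m : ℝ) - A.card) ^ 2 := by
    rw [hEU]
    congr 1
    have : ∀ j ∈ U, sgn x i₀ * sgn y j = 1 - 2 * (if j ∈ A then 1 else 0) := by
      intro j hj
      have h8 := hUsgn j
      rw [if_pos hj] at h8
      rw [hy_def, sgn_flip]
      split_ifs
      · linear_combination -h8
      · linear_combination h8
    rw [Finset.sum_congr rfl this, Finset.sum_sub_distrib, ← Finset.mul_sum, Finset.sum_boole,
      Finset.filter_mem_eq_inter, Finset.inter_comm U A]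
    simp [hU, hAU]
  have h9 : ∑ e : KSet (2 * m) k, (edgeProb p q x e.1 : ℝ) * gain x y e.1
      ≤ -((p - q) / 2 * ((m - 2).choose (k - 2) * ((m : ℝ) ^ 2 - (m - A.card) ^ 2))) := by
    have h10 : ∀ e : KSet (2 * m) k, (edgeProb p q x e.1 : ℝ) * gain x y e.1
        ≤ q * gain x y e.1 + (p - q) * (if e.1 ⊆ U then gain x y e.1 else 0) := by
      intro e
      by_cases hc : InCluster x e.1
      · have : gain x y e.1 ≤ 0 := by
          obtain ⟨a, ha⟩ : e.1.Nonempty := by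
            rw [← Finset.card_pos, e.2]; omega
          have h11 : opp x a e.1 = 0 := (inCluster_iff_opp_eq_zero x ha).1 hc
          have h12 := loc_eq x a e.1
          rw [h11, loc] at h12
          have h13 : edgeSum x e.1 ^ 2 = (e.1.card : ℝ) ^ 2 := by
            have h14 : sgn x a * edgeSum x e.1 = e.1.card := by push_cast at h12; linarith
            rw [← h14, mul_pow, sq (sgn x a), sgn_mul_self, one_mul]
          unfold gain
          linarith [edgeSum_sq_le y e.1]
        rw [edgeProb, if_pos hc]
        split_ifs
        · linarith
        · nlinarith
      · rw [edgeProb, if_neg hc, if_neg]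
        · linarith
        · intro hs
          refine hc fun i hi j hj => ?_
          have hi' := hs hi
          have hj' := hs hj
          simp only [U, Finset.mem_filter, Finset.mem_univ, true_and] at hi' hj'
          rw [hi', hj']
    refine (Finset.sum_le_sum fun e _ => h10 e).trans ?_
    rw [Finset.sum_add_distrib, ← Finset.mul_sum, h5, ← Finset.mul_sum,
      sum_kset fun e => if e ⊆ U then gain x y e else 0, ← Finset.sum_filter]
    have h15 : (Finset.powersetCard k Finset.univ).filter (fun e => e ⊆ U)
        = Finset.powersetCard k U := by
      ext e; simp [Finset.mem_powersetCard, and_comm]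
    have h16 := sum_powersetCard_edgeSum_sq_sub hk U x y
    rw [hxU, hyU, hU] at h16
    have h17 : ∑ e ∈ Finset.powersetCard k U, gain x y e
        = -(1 / 2) * ∑ e ∈ Finset.powersetCard k U, (edgeSum x e ^ 2 - edgeSum y e ^ 2) := by
      rw [Finset.mul_sum]; exact Finset.sum_congr rfl fun e _ => by unfold gain; ring
    rw [h15, h17, h16]
    refine le_of_eq ?_
    ring
  have h18 := mul_le_mul_of_nonneg_left h9 hθ
  nlinarith

/-! ### Vertices that want to change sides -/

/-- The relative label sum `loc x i e`, kept only for the hyperedges that meet `S` in `i` alone. -/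
noncomputable def privateLoc {n : ℕ} (x : Labeling n) (S : Finset (Fin n)) (i : Fin n)
    (e : Finset (Fin n)) : ℝ := if e ∩ S = {i} then loc x i e else 0

/-- Changing the side of `i` improves the objective, as far as the hyperedges that meet `S` in `i`
alone are concerned: the sum of their relative labels at `i` is negative. -/
def wantsFlip {n : ℕ} (k : ℕ) (x : Labeling n) (S : Finset (Fin n)) (i : Fin n) :
    Set (Hypergraph n k) := {H | linStat (fun e : KSet n k => privateLoc x S i e.1) H < 0}

/-- Some hyperedge joins `i` to another vertex of `S`. -/
def joined {n : ℕ} (k : ℕ) (S : Finset (Fin n)) (i : Fin n) : Set (Hypergraph n k) :=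
  {H | ∃ e ∈ Finset.univ.filter fun e : KSet n k => i ∈ e.1 ∧ 2 ≤ (e.1 ∩ S).card, H e = true}

/-- Exchanging two vertices on different sides that want to change sides improves the bisection,
if neither is joined to the rest of `S`. -/
theorem not_isMinBisection_of_wantsFlip {n k : ℕ} {x : Labeling n} {H : Hypergraph n k}
    {S : Finset (Fin n)} {i j : Fin n} (hi : i ∈ S) (hj : j ∈ S) (hij : x i ≠ x j)
    (hi1 : H ∈ wantsFlip k x S i) (hi2 : H ∉ joined k S i)
    (hj1 : H ∈ wantsFlip k x S j) (hj2 : H ∉ joined k S j) :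
    ¬ IsMinBisection H x := by
  rintro ⟨hx, hmax⟩
  have hne : i ≠ j := fun h => hij (by rw [h])
  have hs : sgn x i + sgn x j = 0 := by
    have := sgn_mul_sgn x i j
    rw [if_pos hij.symm] at this
    linear_combination sgn x i * this - sgn x j * sgn_mul_self x i
  have hpair : edgeSum x {i, j} = 0 := by rw [edgeSum, Finset.sum_pair hne, hs]
  have hy : flip {i, j} x ∈ balanced n := by
    rw [mem_balanced_iff] at hx ⊢
    have h := edgeSum_flip {i, j} x Finset.univ
    rw [Finset.univ_inter, hpair, mul_zero, sub_zero] at h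
    exact h.trans hx
  have hle : (bisectionObj H (flip {i, j} x) : ℝ) ≤ bisectionObj H x := by
    exact_mod_cast hmax _ hy
  have hprivate : ∀ a ∈ S, H ∉ joined k S a → ∀ e : KSet n k, H e = true → a ∈ e.1 →
      e.1 ∩ S = {a} := by
    intro a ha hja e he hae
    have h1 : ¬ 2 ≤ (e.1 ∩ S).card := fun h2 =>
      hja ⟨e, Finset.mem_filter.2 ⟨Finset.mem_univ _, hae, h2⟩, he⟩
    refine (Finset.eq_of_subset_of_card_le ?_ (by rw [Finset.card_singleton]; omega)).symm
    rw [Finset.singleton_subset_iff]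
    exact Finset.mem_inter.2 ⟨hae, ha⟩
  have hnot : ∀ a b : Fin n, a ∈ S → b ∈ S → a ≠ b → ∀ e : Finset (Fin n), e ∩ S = {a} → b ∉ e := by
    intro a b _ hb hab e he hbe
    have : b ∈ e ∩ S := Finset.mem_inter.2 ⟨hbe, hb⟩
    rw [he, Finset.mem_singleton] at this
    exact hab this.symm
  have key : linStat (fun e : KSet n k => gain x (flip {i, j} x) e.1) H
      = -2 * linStat (fun e : KSet n k => privateLoc x S i e.1) H
        + -2 * linStat (fun e : KSet n k => privateLoc x S j e.1) H := by
    simp only [linStat, Finset.mul_sum]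
    rw [← Finset.sum_add_distrib]
    refine Finset.sum_congr rfl fun e _ => ?_
    by_cases he : H e = true
    · simp only [he, if_true, privateLoc]
      by_cases hie : i ∈ e.1
      · have h1 := hprivate i hi hi2 e he hie
        have h2 := hnot i j hi hj hne e.1 h1
        have h3 : e.1 ∩ {i, j} = {i} := by
          ext a
          simp only [Finset.mem_inter, Finset.mem_insert, Finset.mem_singleton]
          constructor
          · rintro ⟨h4, rfl | rfl⟩
            · rfl
            · exact absurd h4 h2
          · rintro rfl; exact ⟨hie, .inl rfl⟩
        rw [gain_flip_of_inter_eq_singleton x h3, if_pos h1, if_neg]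
        · ring
        · rw [h1]; exact fun h => hne (Finset.singleton_injective h)
      · have h1 : e.1 ∩ S ≠ {i} := fun h => by
          have : i ∈ e.1 ∩ S := by rw [h]; simp
          exact hie (Finset.mem_inter.1 this).1
        rw [if_neg h1]
        by_cases hje : j ∈ e.1
        · have h2 := hprivate j hj hj2 e he hje
          have h3 : e.1 ∩ {i, j} = {j} := by
            ext a
            simp only [Finset.mem_inter, Finset.mem_insert, Finset.mem_singleton]
            constructor
            · rintro ⟨h4, rfl | rfl⟩
              · exact absurd h4 hie
              · rfl
            · rintro rfl; exact ⟨hje, .inr rfl⟩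
          rw [gain_flip_of_inter_eq_singleton x h3, if_pos h2]
          ring
        · have h2 : e.1 ∩ S ≠ {j} := fun h => by
            have : j ∈ e.1 ∩ S := by rw [h]; simp
            exact hje (Finset.mem_inter.1 this).1
          have h3 : e.1 ∩ {i, j} = ∅ := by
            ext a
            simp only [Finset.mem_inter, Finset.mem_insert, Finset.mem_singleton,
              Finset.notMem_empty, iff_false]
            rintro ⟨h4, rfl | rfl⟩
            · exact hie h4
            · exact hje h4
          rw [if_neg h2, gain_flip_of_edgeSum_inter_eq_zero x (by simp [h3, edgeSum])]
          ring
    · simp [he]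
  have h1 := bisectionObj_sub_eq_linStat H x (flip {i, j} x)
  simp only [wantsFlip, Set.mem_ofPred_eq] at hi1 hj1
  rw [key] at h1
  linarith

theorem linStat_congr_of_forall_ne_zero {ι : Type*} [Fintype ι] {c : ι → ℝ} {H H' : ι → Bool}
    (h : ∀ e, c e ≠ 0 → H e = H' e) : linStat c H = linStat c H' := by
  refine Finset.sum_congr rfl fun e _ => ?_
  by_cases hc : c e = 0
  · simp [hc]
  · rw [h e hc]

/-- If every vertex of `T ⊆ S` wants to change sides with probability at least `ρ`, then with high
probability some vertex of `T` wants to do so and is not joined to the rest of `S`. -/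
theorem measure_forall_wantsFlip_imp_joined_le {n k : ℕ} (hk : 2 ≤ k) {p q : I}
    (hqp : (q : ℝ) ≤ p) (x : Labeling n) {S T : Finset (Fin n)} {ρ : ℝ}
    (hρ : ∀ i ∈ T, ρ ≤ (hypergraphLaw n k p q x).real (wantsFlip k x S i)) :
    (hypergraphLaw n k p q x).real
        {H | ∀ i ∈ T, H ∈ wantsFlip k x S i → H ∈ joined k S i}
      ≤ Real.exp (-(ρ * T.card)) + p * (S.card * (n - 2).choose (k - 2) : ℕ) := by
  classical
  rw [hypergraphLaw_eq] at hρ ⊢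
  have hp0 : 0 ≤ (p : ℝ) := p.2.1
  refine measure_forall_not_le _ T (wantsFlip k x S) (joined k S)
    (fun i => Finset.univ.filter fun e : KSet n k => e.1 ∩ S = {i})
    (Finset.univ.filter fun e : KSet n k => 2 ≤ (e.1 ∩ S).card) ?_ ?_ ?_ ?_ hρ (by positivity) ?_
  · intro i H H' hH
    simp only [wantsFlip, Set.mem_ofPred_eq]
    rw [linStat_congr_of_forall_ne_zero fun e he => hH e ?_]
    simp only [Finset.coe_filter, Finset.mem_univ, true_and, Set.mem_ofPred_eq]
    by_contra h
    exact he (if_neg h)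
  · intro i H H' hH
    simp only [joined, Set.mem_ofPred_eq]
    refine propext (exists_congr fun e => and_congr_right fun he => ?_)
    rw [hH e]
    simp only [Finset.mem_filter, Finset.mem_univ, true_and] at he
    simp [he.2]
  · intro i _ j _ hij
    refine Finset.disjoint_left.2 fun e h1 h2 => hij ?_
    simp only [Finset.mem_filter, Finset.mem_univ, true_and] at h1 h2
    exact Finset.singleton_injective (h1.symm.trans h2)
  · intro i
    refine Finset.disjoint_left.2 fun e h1 h2 => ?_
    simp only [Finset.mem_filter, Finset.mem_univ, true_and] at h1 h2
    rw [h1] at h2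
    simp at h2
  · intro i _
    refine (measure_exists_mem_le _ _).trans ?_
    refine (Finset.sum_le_card_nsmul _ _ (p : ℝ) fun e _ => edgeProb_le hqp x e.1).trans ?_
    rw [nsmul_eq_mul, mul_comm]
    exact mul_le_mul_of_nonneg_left (by exact_mod_cast card_kset_mem_two_le_inter hk S i) hp0

/-- The probability that `x` is a minimum bisection, given `s` candidates on each side that want to
change sides with probability at least `ρ`. -/
theorem measure_isMinBisection_le {n k : ℕ} (hk : 2 ≤ k) {p q : I} (hqp : (q : ℝ) ≤ p)
    {x : Labeling n} {T₁ T₂ : Finset (Fin n)} (hT : ∀ i ∈ T₁, ∀ j ∈ T₂, x i ≠ x j) {s : ℕ}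
    (h₁ : T₁.card = s) (h₂ : T₂.card = s) {ρ : ℝ}
    (hρ : ∀ i ∈ T₁ ∪ T₂, ρ ≤ (hypergraphLaw n k p q x).real (wantsFlip k x (T₁ ∪ T₂) i)) :
    (hypergraphLaw n k p q x).real {H | IsMinBisection H x}
      ≤ 2 * (Real.exp (-(ρ * s)) + p * (2 * s * (n - 2).choose (k - 2) : ℕ)) := by
  set S := T₁ ∪ T₂
  have hp0 : 0 ≤ (p : ℝ) := p.2.1
  have hS : S.card ≤ 2 * s := (Finset.card_union_le _ _).trans (by omega)
  have hS' : (p : ℝ) * (S.card * (n - 2).choose (k - 2) : ℕ)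
      ≤ p * (2 * s * (n - 2).choose (k - 2) : ℕ) :=
    mul_le_mul_of_nonneg_left (by exact_mod_cast Nat.mul_le_mul_right _ hS) hp0
  have hsub : {H : Hypergraph n k | IsMinBisection H x}
      ⊆ {H | ∀ i ∈ T₁, H ∈ wantsFlip k x S i → H ∈ joined k S i}
        ∪ {H | ∀ i ∈ T₂, H ∈ wantsFlip k x S i → H ∈ joined k S i} := by
    intro H hH
    by_contra hcon
    simp only [Set.mem_union, Set.mem_ofPred_eq, not_or, not_forall] at hcon
    obtain ⟨⟨i, hi, hi1, hi2⟩, j, hj, hj1, hj2⟩ := hcon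
    exact not_isMinBisection_of_wantsFlip (Finset.mem_union_left _ hi)
      (Finset.mem_union_right _ hj) (hT i hi j hj) hi1 hi2 hj1 hj2 hH
  refine (measureReal_mono hsub).trans ((measureReal_union_le _ _).trans ?_)
  have m1 := measure_forall_wantsFlip_imp_joined_le hk hqp x (S := S) (T := T₁)
    fun i hi => hρ i (Finset.mem_union_left _ hi)
  have m2 := measure_forall_wantsFlip_imp_joined_le hk hqp x (S := S) (T := T₂)
    fun i hi => hρ i (Finset.mem_union_right _ hi)
  rw [h₁] at m1
  rw [h₂] at m2
  linarith

/-- The exponential moment at `t` of `privateLoc` is close to `exp (-degExp t)`. -/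
theorem prod_privateLoc_bounds {m k : ℕ} (hk : 2 ≤ k) {p q : I} (hqp : (q : ℝ) ≤ p)
    {x : Labeling (2 * m)} (hx : x ∈ balanced (2 * m)) {S : Finset (Fin (2 * m))}
    {i : Fin (2 * m)} (hi : i ∈ S) {t : ℝ} (htp : p * Real.exp (|t| * (k + 1)) ≤ 1 / 2) :
    (∏ e : KSet (2 * m) k, (1 - (edgeProb p q x e.1 : ℝ) *
        (1 - Real.exp (-t * privateLoc x S i e.1)))
      ≤ Real.exp (-degExp m k p q t + p * Real.exp (|t| * (k + 1)) *
          (S.card * (2 * m - 2).choose (k - 2) : ℕ))) ∧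
    Real.exp (-degExp m k p q t - p * Real.exp (|t| * (k + 1)) *
          (S.card * (2 * m - 2).choose (k - 2) : ℕ)
        - 2 * ((p * Real.exp (|t| * (k + 1))) ^ 2 * (2 * m - 1).choose (k - 1)))
      ≤ ∏ e : KSet (2 * m) k, (1 - (edgeProb p q x e.1 : ℝ) *
        (1 - Real.exp (-t * privateLoc x S i e.1))) := by
  set K := Real.exp (|t| * (k + 1))
  have hp0 : 0 ≤ (p : ℝ) := p.2.1
  have hK : 0 < K := Real.exp_pos _
  set X : KSet (2 * m) k → ℝ := fun e => (edgeProb p q x e.1 : ℝ) *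
        (1 - Real.exp (-t * privateLoc x S i e.1)) with hX
  have hterm : ∀ e : KSet (2 * m) k,
      |(edgeProb p q x e.1 : ℝ) * (1 - Real.exp (-t * loc x i e.1))| ≤ p * K := by
    intro e
    rw [abs_mul, abs_of_nonneg (edgeProb p q x e.1).2.1]
    refine mul_le_mul (edgeProb_le hqp x e.1) ((abs_one_sub_exp_le _).trans
      (Real.exp_le_exp.2 ?_)) (abs_nonneg _) hp0
    rw [abs_mul, abs_neg]
    have h := abs_loc_le x i e.1
    rw [e.2] at h
    exact mul_le_mul_of_nonneg_left h (abs_nonneg _)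
  have hmem : ∀ e : KSet (2 * m) k, e.1 ∩ S = {i} → i ∈ e.1 := fun e he => by
    have : i ∈ e.1 ∩ S := by rw [he]; simp
    exact (Finset.mem_inter.1 this).1
  have hXeq : ∀ e, X e = if e.1 ∩ S = {i} then
      (edgeProb p q x e.1 : ℝ) * (1 - Real.exp (-t * loc x i e.1)) else 0 := by
    intro e
    simp only [hX, privateLoc]
    split_ifs <;> simp
  have hXabs : ∀ e, |X e| ≤ if i ∈ e.1 then p * K else 0 := by
    intro e
    rw [hXeq]
    by_cases he : e.1 ∩ S = {i}
    · rw [if_pos he, if_pos (hmem e he)]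
      exact hterm e
    · rw [if_neg he, abs_zero]
      split_ifs <;> positivity
  have hXhalf : ∀ e, |X e| ≤ 1 / 2 := fun e => (hXabs e).trans (by
    split_ifs
    · exact htp
    · norm_num)
  -- the difference to the sum over all hyperedges at `i`
  have hdiff : |∑ e, X e - degExp m k p q t| ≤ p * K *
      (S.card * (2 * m - 2).choose (k - 2) : ℕ) := by
    rw [← sum_mem_exp_loc_eq_degExp hx i t, ← Finset.sum_sub_distrib]
    refine (Finset.abs_sum_le_sum_abs _ _).trans ?_
    have h1 : ∀ e : KSet (2 * m) k, |X e - (if i ∈ e.1 then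
        (edgeProb p q x e.1 : ℝ) * (1 - Real.exp (-t * loc x i e.1)) else 0)|
        ≤ if i ∈ e.1 ∧ 2 ≤ (e.1 ∩ S).card then p * K else 0 := by
      intro e
      rw [hXeq]
      by_cases he : e.1 ∩ S = {i}
      · rw [if_pos he, if_pos (hmem e he), sub_self, abs_zero]
        split_ifs <;> positivity
      · rw [if_neg he, zero_sub, abs_neg]
        by_cases hie : i ∈ e.1
        · have h2 : 2 ≤ (e.1 ∩ S).card := by
            by_contra h2
            refine he (Finset.eq_of_subset_of_card_le ?_ ?_).symm
            · rw [Finset.singleton_subset_iff]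
              exact Finset.mem_inter.2 ⟨hie, hi⟩
            · rw [Finset.card_singleton]; omega
          rw [if_pos hie, if_pos ⟨hie, h2⟩]
          exact hterm e
        · rw [if_neg hie, abs_zero]
          split_ifs <;> positivity
    refine (Finset.sum_le_sum fun e _ => h1 e).trans ?_
    rw [← Finset.sum_filter, Finset.sum_const, nsmul_eq_mul, mul_comm]
    exact mul_le_mul_of_nonneg_left (by exact_mod_cast card_kset_mem_two_le_inter hk S i)
      (by positivity)
  have hsq : ∑ e, X e ^ 2 ≤ (p * K) ^ 2 * (2 * m - 1).choose (k - 1) := by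
    have h1 : ∀ e, X e ^ 2 ≤ if i ∈ e.1 then (p * K) ^ 2 else 0 := by
      intro e
      rw [← sq_abs]
      refine (pow_le_pow_left₀ (abs_nonneg _) (hXabs e) 2).trans (le_of_eq ?_)
      split_ifs <;> simp
    refine (Finset.sum_le_sum fun e _ => h1 e).trans (le_of_eq ?_)
    rw [← Finset.sum_filter, Finset.sum_const, card_kset_mem (by omega), nsmul_eq_mul, mul_comm]
  obtain ⟨hd1, hd2⟩ := abs_le.1 hdiff
  constructor
  · refine (prod_one_sub_le_exp _ _ fun e _ => ?_).trans (Real.exp_le_exp.2 (by linarith))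
    linarith [(abs_le.1 (hXhalf e)).2]
  · refine le_trans (Real.exp_le_exp.2 ?_) (exp_le_prod_one_sub _ _ fun e _ => hXhalf e)
    linarith

/-! ### The rate function -/

/-- The weights of the exponentials in the rate function. -/
noncomputable def rateWeight (k : ℕ) (α β : ℝ) (r : ℕ) : ℝ :=
  ((k - 1).choose r : ℝ) / 2 ^ (k - 1) * (if r = 0 then α else β)

theorem rate_eq_sum {k : ℕ} (hk : 2 ≤ k) (α β t : ℝ) :
    rate k α β t = ∑ r ∈ Finset.range k,
      rateWeight k α β r * (1 - Real.exp (-t * ((k : ℝ) - 1 - 2 * r))) := by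
  have hr : Finset.range k = insert 0 (Finset.Icc 1 (k - 1)) := by
    ext r; simp only [Finset.mem_range, Finset.mem_insert, Finset.mem_Icc]; omega
  rw [hr, Finset.sum_insert (by simp), rate, mul_add, Finset.mul_sum]
  congr 1
  · simp [rateWeight]; ring_nf
  · refine Finset.sum_congr rfl fun r hr => ?_
    have : r ≠ 0 := by have := (Finset.mem_Icc.1 hr).1; omega
    rw [rateWeight, if_neg this]
    ring_nf

theorem rateWeight_nonneg {k : ℕ} {α β : ℝ} (hα : 0 ≤ α) (hβ : 0 ≤ β) (r : ℕ) :
    0 ≤ rateWeight k α β r := by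
  unfold rateWeight; split_ifs <;> positivity

theorem rate_zero (k : ℕ) (α β : ℝ) : rate k α β 0 = 0 := by simp [rate]

theorem differentiable_rate (k : ℕ) (α β : ℝ) : Differentiable ℝ (rate k α β) := by
  unfold rate; fun_prop

/-- The rate tends to `-∞` because of its last exponential, so its supremum over `t ≥ 0` is a
maximum over a compact interval. -/
theorem rate_nonpos_of_large {k : ℕ} (hk : 2 ≤ k) {α β : ℝ} (hα : 0 ≤ α) (hβ : 0 < β) :
    ∃ T : ℝ, 0 ≤ T ∧ ∀ t, T ≤ t → rate k α β t ≤ 0 := by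
  set W := ∑ r ∈ Finset.range k, rateWeight k α β r
  have hw := rateWeight_nonneg (k := k) hα hβ.le
  have hW : 0 ≤ W := Finset.sum_nonneg fun r _ => hw r
  set w := rateWeight k α β (k - 1)
  have hw' : 0 < w := by
    simp only [w, rateWeight]
    rw [if_neg (by omega), Nat.choose_self]
    positivity
  refine ⟨W / w, by positivity, fun t ht => ?_⟩
  have ht0 : 0 ≤ t := le_trans (by positivity) ht
  -- the last exponential alone outweighs all the constants
  have h1 : ∀ r ∈ Finset.range k,
      rateWeight k α β r * (1 - Real.exp (-t * ((k : ℝ) - 1 - 2 * r)))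
      ≤ rateWeight k α β r - (if r = k - 1 then w * t else 0) := by
    intro r _
    split_ifs with h
    · have h2 : ((k - 1 : ℕ) : ℝ) = (k : ℝ) - 1 := by
        push_cast [Nat.cast_sub (by omega : 1 ≤ k)]; ring
      have h3 := Real.add_one_le_exp (-t * ((k : ℝ) - 1 - 2 * r))
      have h4 : -t * ((k : ℝ) - 1 - 2 * r) = t * ((k : ℝ) - 1) := by rw [h, h2]; ring
      have h5 : (2 : ℝ) ≤ k := by exact_mod_cast hk
      have h6 : t ≤ Real.exp (-t * ((k : ℝ) - 1 - 2 * r)) := by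
        rw [h4] at h3 ⊢; nlinarith
      subst h
      have := mul_le_mul_of_nonneg_left h6 hw'.le
      simp only [w] at *
      linarith
    · have := mul_nonneg (hw r) (Real.exp_pos (-t * ((k : ℝ) - 1 - 2 * r))).le
      linarith
  rw [rate_eq_sum hk]
  refine (Finset.sum_le_sum h1).trans ?_
  rw [Finset.sum_sub_distrib, Finset.sum_ite_eq' , if_pos (Finset.mem_range.2 (by omega))]
  have := mul_le_mul_of_nonneg_left ht hw'.le
  rw [mul_div_cancel₀ _ hw'.ne'] at this
  linarith

theorem isGreatest_I₂ {k : ℕ} (hk : 2 ≤ k) {α β : ℝ} (hα : 0 ≤ α) (hβ : 0 < β) :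
    IsGreatest (rate k α β '' Set.Ici 0) (I₂ k α β) := by
  obtain ⟨T, hT0, hT⟩ := rate_nonpos_of_large hk hα hβ
  obtain ⟨t, ht, hmax⟩ := isCompact_Icc.exists_isMaxOn (Set.nonempty_Icc.2 hT0)
    (differentiable_rate k α β).continuous.continuousOn
  have h : IsGreatest (rate k α β '' Set.Ici 0) (rate k α β t) := by
    refine ⟨⟨t, ht.1, rfl⟩, ?_⟩
    rintro _ ⟨s, hs, rfl⟩
    rcases le_total s T with h | h
    · exact hmax ⟨hs, h⟩
    · refine (hT s h).trans ?_
      rw [← rate_zero k α β]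
      exact hmax ⟨le_rfl, hT0⟩
  rw [I₂, h.csSup_eq]
  exact h

/-- The part of the rate function with weight `β` throughout is even, and the rest increases. -/
theorem rate_neg_le {k : ℕ} (hk : 2 ≤ k) {α β : ℝ} (hαβ : β ≤ α) {t : ℝ} (ht : 0 ≤ t) :
    rate k α β (-t) ≤ rate k α β t := by
  have h1 : ∀ t, rate k α β t = rate k β β t
      + (α - β) / 2 ^ (k - 1) * (1 - Real.exp (-((k : ℝ) - 1) * t)) := by
    intro t; simp only [rate]; ring
  have h2 : rate k β β (-t) = rate k β β t := by
    rw [rate_eq_sum hk, rate_eq_sum hk, ← Finset.sum_range_reflect]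
    refine Finset.sum_congr rfl fun r hr => ?_
    have hr' : r ≤ k - 1 := by have := Finset.mem_range.1 hr; omega
    simp only [rateWeight, ite_self]
    rw [Nat.choose_symm hr', Nat.cast_sub hr', Nat.cast_sub (by omega : 1 ≤ k)]
    congr 3
    push_cast
    ring
  rw [h1, h1 t, h2]
  have hk' : (2 : ℝ) ≤ k := by exact_mod_cast hk
  have h3 : Real.exp (-((k : ℝ) - 1) * t) ≤ Real.exp (-((k : ℝ) - 1) * (-t)) :=
    Real.exp_le_exp.2 (by nlinarith)
  have h4 : 0 ≤ (α - β) / 2 ^ (k - 1) := div_nonneg (by linarith) (by positivity)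
  have := mul_le_mul_of_nonneg_left h3 h4
  linarith

theorem exp_midpoint_le (a b : ℝ) :
    Real.exp ((a + b) / 2) ≤ (Real.exp a + Real.exp b) / 2 := by
  have h1 : Real.exp ((a + b) / 2) = Real.exp (a / 2) * Real.exp (b / 2) := by
    rw [← Real.exp_add]; ring_nf
  have h2 : ∀ c : ℝ, Real.exp c = Real.exp (c / 2) ^ 2 := fun c => by
    rw [sq, ← Real.exp_add]; ring_nf
  rw [h1, h2 a, h2 b]
  nlinarith [sq_nonneg (Real.exp (a / 2) - Real.exp (b / 2))]

theorem exp_midpoint_lt {a b : ℝ} (h : a ≠ b) :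
    Real.exp ((a + b) / 2) < (Real.exp a + Real.exp b) / 2 := by
  have h1 : Real.exp ((a + b) / 2) = Real.exp (a / 2) * Real.exp (b / 2) := by
    rw [← Real.exp_add]; ring_nf
  have h2 : ∀ c : ℝ, Real.exp c = Real.exp (c / 2) ^ 2 := fun c => by
    rw [sq, ← Real.exp_add]; ring_nf
  have h3 : Real.exp (a / 2) - Real.exp (b / 2) ≠ 0 := fun h' => h (by
    have := Real.exp_injective (sub_eq_zero.1 h'); linarith)
  rw [h1, h2 a, h2 b]
  nlinarith [sq_pos_of_ne_zero h3]

/-- The rate is strictly concave, hence has only one maximizer. -/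
theorem rate_midpoint_lt {k : ℕ} (hk : 2 ≤ k) {α β : ℝ} (hα : 0 < α) (hβ : 0 ≤ β) {s t : ℝ}
    (hst : s ≠ t) : (rate k α β s + rate k α β t) / 2 < rate k α β ((s + t) / 2) := by
  have hk' : (2 : ℝ) ≤ k := by exact_mod_cast hk
  rw [rate_eq_sum hk, rate_eq_sum hk, rate_eq_sum hk, ← Finset.sum_add_distrib, Finset.sum_div]
  refine Finset.sum_lt_sum (fun r _ => ?_) ⟨0, Finset.mem_range.2 (by omega), ?_⟩
  · have h := exp_midpoint_le (-s * ((k : ℝ) - 1 - 2 * r)) (-t * ((k : ℝ) - 1 - 2 * r))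
    rw [show (-s * ((k : ℝ) - 1 - 2 * r) + -t * ((k : ℝ) - 1 - 2 * r)) / 2
      = -((s + t) / 2) * ((k : ℝ) - 1 - 2 * r) by ring] at h
    have := mul_le_mul_of_nonneg_left h (rateWeight_nonneg (k := k) hα.le hβ r)
    linarith
  · have h := exp_midpoint_lt (a := -s * ((k : ℝ) - 1 - 2 * (0 : ℕ)))
      (b := -t * ((k : ℝ) - 1 - 2 * (0 : ℕ))) (fun h => hst (by
        have h2 : (k : ℝ) - 1 - 2 * (0 : ℕ) ≠ 0 := by push_cast; linarith
        have := mul_right_cancel₀ h2 h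
        linarith))
    rw [show (-s * ((k : ℝ) - 1 - 2 * (0 : ℕ)) + -t * ((k : ℝ) - 1 - 2 * (0 : ℕ))) / 2
      = -((s + t) / 2) * ((k : ℝ) - 1 - 2 * (0 : ℕ)) by ring] at h
    have hw : 0 < rateWeight k α β 0 := by simp [rateWeight, hα]
    have := mul_lt_mul_of_pos_left h hw
    linarith

/-- Parameters for the lower bound: `t` slightly to the right of the maximizer of the rate, so that
the mean of the tilted statistic is slightly negative. -/
theorem exists_tilt {k : ℕ} (hk : 2 ≤ k) {α β : ℝ} (hβ : 0 < β) (hαβ : β < α)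
    (hI : I₂ k α β < 1) :
    ∃ t u ε : ℝ, 0 ≤ t ∧ 0 < u ∧ 0 < ε ∧ rate k α β t + t * ε < 1 ∧
      rate k α β t < rate k α β (t - u) ∧ rate k α β t < rate k α β (t + u) + u * ε := by
  obtain ⟨⟨τ, hτ, hτI⟩, hmax⟩ := isGreatest_I₂ hk (hβ.trans hαβ).le hβ
  have hτ0 : 0 ≤ τ := hτ
  have hglob : ∀ s, rate k α β s ≤ rate k α β τ := by
    intro s
    rw [hτI]
    rcases le_total 0 s with h | h
    · exact hmax ⟨s, h, rfl⟩
    · have := rate_neg_le hk hαβ.le (neg_nonneg.2 h)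
      rw [neg_neg] at this
      exact this.trans (hmax ⟨-s, neg_nonneg.2 h, rfl⟩)
  have hstrict : ∀ s, s ≠ τ → rate k α β s < rate k α β τ := by
    intro s hs
    have := rate_midpoint_lt hk (hβ.trans hαβ) hβ.le hs
    have := hglob ((s + τ) / 2)
    linarith
  have hderiv : HasDerivAt (rate k α β) 0 τ := by
    have h := (differentiable_rate k α β τ).hasDerivAt
    rwa [IsLocalMax.deriv_eq_zero (Eventually.of_forall hglob)] at h
  set ε := (1 - I₂ k α β) / (2 * (τ + 1)) with hε
  have hε0 : 0 < ε := div_pos (by linarith) (by linarith)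
  have hετ : (τ + 1) * ε = (1 - I₂ k α β) / 2 := by
    rw [hε]; field_simp
  obtain ⟨η, hη, hball⟩ := Metric.eventually_nhds_iff.1
    ((hasDerivAt_iff_isLittleO.1 hderiv).bound (by positivity : 0 < ε / 4))
  set u := min (η / 4) 1 with hu
  have hu0 : 0 < u := by positivity
  have hu1 : u ≤ 1 := min_le_right _ _
  have hu2 : u ≤ η / 4 := min_le_left _ _
  have hlin : ∀ c, 0 < c → c < η → |rate k α β (τ + c) - rate k α β τ| ≤ ε / 4 * c := by
    intro c hc hcη
    have := hball (y := τ + c) (by rw [Real.dist_eq]; simpa [abs_of_pos hc] using hcη)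
    simpa [abs_of_pos hc] using this
  refine ⟨τ + u, u, ε, by linarith, hu0, hε0, ?_, ?_, ?_⟩
  · have h1 := hglob (τ + u)
    rw [hτI] at h1
    nlinarith
  · rw [add_sub_cancel_right]
    exact hstrict _ (by linarith)
  · have h1 := hlin u hu0 (by linarith)
    have h2 := hlin (u + u) (by linarith) (by linarith)
    rw [← add_assoc] at h2
    have h3 := (abs_le.1 h1).2
    have h4 := (abs_le.1 h2).1
    nlinarith [mul_pos hu0 hε0]

/-! ### Asymptotics of the binomial coefficients -/

theorem tendsto_choose_div_pow {f : ℕ → ℕ} {c : ℝ} (hf : Tendsto f atTop atTop)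
    (hfc : Tendsto (fun m => (f m : ℝ) / m) atTop (𝓝 c)) (a : ℕ) :
    Tendsto (fun m => ((f m).choose a : ℝ) / (m : ℝ) ^ a) atTop
      (𝓝 (c ^ a / a.factorial)) := by
  have h1 := (isEquivalent_choose a).comp_tendsto hf
  have hne : ∀ᶠ m in atTop, ((f m : ℝ) ^ a / a.factorial) ≠ 0 := by
    filter_upwards [hf.eventually_ge_atTop 1] with m hm
    have : (0 : ℝ) < f m := by exact_mod_cast hm
    positivity
  have h2 := (Asymptotics.isEquivalent_iff_tendsto_one hne).1 h1
  have h3 := h2.mul ((hfc.pow a).div_const (a.factorial : ℝ))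
  rw [one_mul] at h3
  refine h3.congr' ?_
  filter_upwards [hne] with m hm
  simp only [Pi.div_apply, Function.comp_apply]
  have : ((f m : ℝ)) ^ a ≠ 0 := fun h => hm (by simp [h])
  rw [div_pow]
  field_simp

theorem tendsto_natCast_sub_div (c d : ℕ) (hc : 1 ≤ c) :
    Tendsto (fun m : ℕ => ((c * m - d : ℕ) : ℝ) / m) atTop (𝓝 c) := by
  have h : Tendsto (fun m : ℕ => (c : ℝ) - (d : ℝ) / m) atTop (𝓝 ((c : ℝ) - 0)) :=
    tendsto_const_nhds.sub (tendsto_const_div_atTop_nhds_zero_nat _)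
  rw [sub_zero] at h
  refine h.congr' ?_
  filter_upwards [eventually_ge_atTop (d + 1)] with m hm
  have h1 : d ≤ c * m := by nlinarith
  have h2 : (m : ℝ) ≠ 0 := by exact_mod_cast (by omega : m ≠ 0)
  rw [Nat.cast_sub h1]
  push_cast
  field_simp

theorem tendsto_choose_mul_sub_div (c d a : ℕ) (hc : 1 ≤ c) :
    Tendsto (fun m : ℕ => ((c * m - d).choose a : ℝ) / (m : ℝ) ^ a) atTop
      (𝓝 ((c : ℝ) ^ a / a.factorial)) := by
  refine tendsto_choose_div_pow ?_ (tendsto_natCast_sub_div c d hc) a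
  refine tendsto_atTop.2 fun b => ?_
  filter_upwards [eventually_ge_atTop (d + b)] with m hm
  have : m ≤ c * m := Nat.le_mul_of_pos_left _ hc
  omega

theorem choose_pos_eventually (k : ℕ) :
    ∀ᶠ m : ℕ in atTop, 0 < ((2 * m - 1).choose (k - 1) : ℝ) := by
  filter_upwards [eventually_ge_atTop (k + 1)] with m hm
  exact_mod_cast Nat.choose_pos (by omega)

/-- The limits of ratios of binomial coefficients to the expected degree normalization. -/
theorem tendsto_choose_mul_pow_div_choose (c d a b k : ℕ) (hc : 1 ≤ c) (hab : a + b = k - 1) :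
    Tendsto (fun m : ℕ => ((c * m - d).choose a : ℝ) * (m : ℝ) ^ b / (2 * m - 1).choose (k - 1))
      atTop (𝓝 ((c : ℝ) ^ a / a.factorial / (2 ^ (k - 1) / (k - 1).factorial))) := by
  have h1 := tendsto_choose_mul_sub_div c d a hc
  have h2 := tendsto_choose_mul_sub_div 2 1 (k - 1) (by norm_num)
  have h3 := h1.div h2 (by positivity)
  push_cast at h3
  refine h3.congr' ?_
  filter_upwards [eventually_gt_atTop 0, choose_pos_eventually k] with m hm hpos
  have hm' : (m : ℝ) ≠ 0 := by positivity
  simp only [Pi.div_apply]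
  rw [← hab] at hpos ⊢
  rw [pow_add]
  field_simp

theorem tendsto_choose_mul_choose_div {k r : ℕ} (hr : r + 1 ≤ k) :
    Tendsto (fun m : ℕ => (((m - 1).choose (k - 1 - r) * m.choose r : ℕ) : ℝ)
      / (2 * m - 1).choose (k - 1)) atTop (𝓝 (((k - 1).choose r : ℝ) / 2 ^ (k - 1))) := by
  have h1 := tendsto_choose_mul_sub_div 1 1 (k - 1 - r) le_rfl
  have h2 := tendsto_choose_mul_sub_div 1 0 r le_rfl
  have h3 := tendsto_choose_mul_sub_div 2 1 (k - 1) (by norm_num)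
  have h4 := (h1.mul h2).div h3 (by positivity)
  have h5 : ((1 : ℕ) : ℝ) ^ (k - 1 - r) / (k - 1 - r).factorial
      * (((1 : ℕ) : ℝ) ^ r / r.factorial) / (((2 : ℕ) : ℝ) ^ (k - 1) / (k - 1).factorial)
      = ((k - 1).choose r : ℝ) / 2 ^ (k - 1) := by
    rw [Nat.cast_choose ℝ (by omega : r ≤ k - 1)]
    simp
    field_simp
  rw [h5] at h4
  refine h4.congr' ?_
  filter_upwards [eventually_gt_atTop 0, choose_pos_eventually k] with m hm hpos
  have hm' : (m : ℝ) ≠ 0 := by positivity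
  have hpow : (m : ℝ) ^ (k - 1) = (m : ℝ) ^ (k - 1 - r) * (m : ℝ) ^ r := by
    rw [← pow_add]; congr 1; omega
  simp only [Pi.div_apply, one_mul, Nat.sub_zero]
  rw [hpow]
  push_cast
  field_simp

/-! ### Asymptotics of the exponents -/

section Asymptotics

theorem tendsto_log_two_mul : Tendsto (fun m : ℕ => Real.log ((2 * m : ℕ) : ℝ)) atTop atTop :=
  Real.tendsto_log_atTop.comp (tendsto_natCast_atTop_atTop.comp
    (tendsto_id.const_mul_atTop' (by norm_num)))

theorem exp_log_two_mul : ∀ᶠ m : ℕ in atTop, Real.exp (Real.log ((2 * m : ℕ) : ℝ)) = 2 * m := by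
  filter_upwards [eventually_gt_atTop 0] with m hm
  rw [Real.exp_log (by positivity)]
  push_cast; ring

/-- `n ^ (-c) * log n` tends to zero. -/
theorem tendsto_exp_neg_log_mul_log {c : ℝ} (hc : 0 < c) :
    Tendsto (fun m : ℕ => Real.exp (-(c * Real.log ((2 * m : ℕ) : ℝ)))
      * Real.log ((2 * m : ℕ) : ℝ)) atTop (𝓝 0) := by
  have h1 := (Real.tendsto_pow_mul_exp_neg_atTop_nhds_zero 1).comp
    (tendsto_log_two_mul.const_mul_atTop hc)
  have h2 := h1.const_mul (1 / c)
  rw [mul_zero] at h2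
  refine h2.congr fun m => ?_
  simp only [Function.comp_apply, pow_one]
  field_simp

theorem tendsto_log_two_mul_div : Tendsto (fun m : ℕ => Real.log ((2 * m : ℕ) : ℝ) / m) atTop
    (𝓝 0) := by
  have h := (tendsto_exp_neg_log_mul_log one_pos).const_mul 2
  rw [mul_zero] at h
  refine h.congr' ?_
  filter_upwards [exp_log_two_mul, eventually_gt_atTop 0] with m hm hm0
  rw [one_mul, Real.exp_neg, hm]
  field_simp

variable {k : ℕ} {α β : ℝ} {p q : ℕ → unitInterval}

theorem tendsto_degExp_div_log (hk : 2 ≤ k)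
    (hp : ∀ᶠ m : ℕ in atTop,
      (p m : ℝ) = α * Real.log ((2 * m : ℕ) : ℝ) / ((2 * m - 1).choose (k - 1) : ℝ))
    (hq : ∀ᶠ m : ℕ in atTop,
      (q m : ℝ) = β * Real.log ((2 * m : ℕ) : ℝ) / ((2 * m - 1).choose (k - 1) : ℝ)) (t : ℝ) :
    Tendsto (fun m => degExp m k (p m) (q m) t / Real.log ((2 * m : ℕ) : ℝ)) atTop
      (𝓝 (rate k α β t)) := by
  rw [rate_eq_sum hk]
  have h : Tendsto (fun m : ℕ => ∑ r ∈ Finset.range k,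
      (((m - 1).choose (k - 1 - r) * m.choose r : ℕ) : ℝ) / (2 * m - 1).choose (k - 1)
        * (if r = 0 then α else β) * (1 - Real.exp (-t * ((k : ℝ) - 1 - 2 * r)))) atTop
      (𝓝 (∑ r ∈ Finset.range k,
        rateWeight k α β r * (1 - Real.exp (-t * ((k : ℝ) - 1 - 2 * r))))) := by
    refine tendsto_finsetSum _ fun r hr => ?_
    exact ((tendsto_choose_mul_choose_div (Finset.mem_range.1 hr)).mul_const _).mul_const _
  refine h.congr' ?_
  filter_upwards [hp, hq, tendsto_log_two_mul.eventually_gt_atTop 0] with m hpm hqm hL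
  rw [degExp, Finset.sum_div]
  refine Finset.sum_congr rfl fun r _ => ?_
  rw [hpm, hqm]
  split_ifs <;> field_simp

/-- The constant in the expected number of hyperedges through a pair of vertices. -/
theorem exists_tendsto_pair_degree (hk : 2 ≤ k)
    (hp : ∀ᶠ m : ℕ in atTop,
      (p m : ℝ) = α * Real.log ((2 * m : ℕ) : ℝ) / ((2 * m - 1).choose (k - 1) : ℝ)) :
    ∃ κ : ℝ, Tendsto (fun m : ℕ => (p m : ℝ) * (2 * m - 2).choose (k - 2) * m
      / Real.log ((2 * m : ℕ) : ℝ)) atTop (𝓝 κ) := by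
  have h := (tendsto_choose_mul_pow_div_choose 2 2 (k - 2) 1 k (by norm_num)
    (by omega)).const_mul α
  refine ⟨_, h.congr' ?_⟩
  filter_upwards [hp, tendsto_log_two_mul.eventually_gt_atTop 0] with m hpm hL
  rw [hpm]
  field_simp

/-- The order of the mean loss of a competitor that differs from `x` on a set of linear size. -/
theorem exists_tendsto_cluster_excess (hk : 2 ≤ k) (hαβ : β < α)
    (hp : ∀ᶠ m : ℕ in atTop,
      (p m : ℝ) = α * Real.log ((2 * m : ℕ) : ℝ) / ((2 * m - 1).choose (k - 1) : ℝ))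
    (hq : ∀ᶠ m : ℕ in atTop,
      (q m : ℝ) = β * Real.log ((2 * m : ℕ) : ℝ) / ((2 * m - 1).choose (k - 1) : ℝ)) :
    ∃ κ : ℝ, 0 < κ ∧ Tendsto (fun m : ℕ => ((p m : ℝ) - q m) * (m - 2).choose (k - 2) * m
      / Real.log ((2 * m : ℕ) : ℝ)) atTop (𝓝 κ) := by
  have h := (tendsto_choose_mul_pow_div_choose 1 2 (k - 2) 1 k (by norm_num)
    (by omega)).const_mul (α - β)
  refine ⟨_, mul_pos (sub_pos.2 hαβ) (by positivity), h.congr' ?_⟩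
  filter_upwards [hp, hq, tendsto_log_two_mul.eventually_gt_atTop 0] with m hpm hqm hL
  rw [hpm, hqm, one_mul]
  field_simp

theorem tendsto_edgeProb_zero (hk : 2 ≤ k)
    (hp : ∀ᶠ m : ℕ in atTop,
      (p m : ℝ) = α * Real.log ((2 * m : ℕ) : ℝ) / ((2 * m - 1).choose (k - 1) : ℝ)) :
    Tendsto (fun m => (p m : ℝ)) atTop (𝓝 0) := by
  obtain ⟨κ, hκ⟩ := exists_tendsto_pair_degree hk hp
  have h := hκ.mul tendsto_log_two_mul_div
  rw [mul_zero] at h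
  refine squeeze_zero' (Eventually.of_forall fun m => (p m).2.1) ?_ h
  filter_upwards [tendsto_log_two_mul.eventually_gt_atTop 0, eventually_ge_atTop k] with m hL hm
  have h1 : (1 : ℝ) ≤ (2 * m - 2).choose (k - 2) := by
    exact_mod_cast Nat.choose_pos (by omega)
  have h2 : (m : ℝ) ≠ 0 := by exact_mod_cast (by omega : m ≠ 0)
  have h3 : (p m : ℝ) * (2 * m - 2).choose (k - 2) * m / Real.log ((2 * m : ℕ) : ℝ)
      * (Real.log ((2 * m : ℕ) : ℝ) / m) = (p m : ℝ) * (2 * m - 2).choose (k - 2) := by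
    field_simp
  rw [h3]
  exact le_mul_of_one_le_right (p m).2.1 h1

theorem edgeProb_mul_choose (hk : 2 ≤ k)
    (hp : ∀ᶠ m : ℕ in atTop,
      (p m : ℝ) = α * Real.log ((2 * m : ℕ) : ℝ) / ((2 * m - 1).choose (k - 1) : ℝ)) :
    ∀ᶠ m : ℕ in atTop, (p m : ℝ) * (2 * m).choose k
      = α * Real.log ((2 * m : ℕ) : ℝ) * (2 * m) / k := by
  filter_upwards [hp, choose_pos_eventually k, eventually_gt_atTop 0] with m hpm hpos hm
  have h := Nat.add_one_mul_choose_eq (2 * m - 1) (k - 1)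
  rw [show 2 * m - 1 + 1 = 2 * m by omega, show k - 1 + 1 = k by omega] at h
  have h' : (2 * m : ℝ) * (2 * m - 1).choose (k - 1) = (2 * m).choose k * k := by
    exact_mod_cast h
  have hk' : (k : ℝ) ≠ 0 := by exact_mod_cast (by omega : k ≠ 0)
  rw [hpm]
  field_simp
  linear_combination (-(α * Real.log ((2 * m : ℕ) : ℝ))) * h'

theorem eventually_le_of_lt (hαβ : β < α)
    (hp : ∀ᶠ m : ℕ in atTop,
      (p m : ℝ) = α * Real.log ((2 * m : ℕ) : ℝ) / ((2 * m - 1).choose (k - 1) : ℝ))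
    (hq : ∀ᶠ m : ℕ in atTop,
      (q m : ℝ) = β * Real.log ((2 * m : ℕ) : ℝ) / ((2 * m - 1).choose (k - 1) : ℝ)) :
    ∀ᶠ m in atTop, (q m : ℝ) ≤ p m := by
  filter_upwards [hp, hq, tendsto_log_two_mul.eventually_gt_atTop 0] with m hpm hqm hL
  rw [hpm, hqm]
  gcongr

/-! ### Below the threshold -/

/-- The exponential moment at `t` of `privateLoc` is `n ^ (-rate t + o(1))`, uniformly in the labels
and in the set `S`, if `S` has at most `s m = o(m)` elements. -/
theorem eventually_prod_privateLoc_bounds (hk : 2 ≤ k) (hαβ : β < α)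
    (hp : ∀ᶠ m : ℕ in atTop,
      (p m : ℝ) = α * Real.log ((2 * m : ℕ) : ℝ) / ((2 * m - 1).choose (k - 1) : ℝ))
    (hq : ∀ᶠ m : ℕ in atTop,
      (q m : ℝ) = β * Real.log ((2 * m : ℕ) : ℝ) / ((2 * m - 1).choose (k - 1) : ℝ))
    {s : ℕ → ℕ} (hs : Tendsto (fun m => (s m : ℝ) / m) atTop (𝓝 0)) (t : ℝ) {δ : ℝ} (hδ : 0 < δ) :
    ∀ᶠ m : ℕ in atTop, ∀ x ∈ balanced (2 * m), ∀ S : Finset (Fin (2 * m)), S.card ≤ s m →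
      ∀ i ∈ S,
      (∏ e : KSet (2 * m) k, (1 - (edgeProb (p m) (q m) x e.1 : ℝ) *
          (1 - Real.exp (-t * privateLoc x S i e.1)))
        ≤ Real.exp (-((rate k α β t - δ) * Real.log ((2 * m : ℕ) : ℝ)))) ∧
      (Real.exp (-((rate k α β t + δ) * Real.log ((2 * m : ℕ) : ℝ)))
        ≤ ∏ e : KSet (2 * m) k, (1 - (edgeProb (p m) (q m) x e.1 : ℝ) *
          (1 - Real.exp (-t * privateLoc x S i e.1)))) := by
  set E := Real.exp (|t| * (k + 1))
  have hE : 0 < E := Real.exp_pos _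
  obtain ⟨κ, hκ⟩ := exists_tendsto_pair_degree hk hp
  have hp0 := tendsto_edgeProb_zero hk hp
  have h1 : Tendsto (fun m : ℕ => (p m : ℝ) * (2 * m - 2).choose (k - 2) * m
      / Real.log ((2 * m : ℕ) : ℝ) * ((s m : ℝ) / m) * E) atTop (𝓝 0) := by
    simpa using (hκ.mul hs).mul_const E
  have h2 : Tendsto (fun m : ℕ => (p m : ℝ) * (2 * E ^ 2 * α)) atTop (𝓝 0) := by
    simpa using hp0.mul_const (2 * E ^ 2 * α)
  have h3 : Tendsto (fun m : ℕ => (p m : ℝ) * E) atTop (𝓝 0) := by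
    simpa using hp0.mul_const E
  have h4 := tendsto_degExp_div_log hk hp hq t
  filter_upwards [hp, h1.eventually_lt_const (by positivity : 0 < δ / 4),
    h2.eventually_lt_const (by positivity : 0 < δ / 4),
    h3.eventually_lt_const (by norm_num : (0 : ℝ) < 1 / 2),
    h4.eventually_lt_const (by linarith : rate k α β t < rate k α β t + δ / 4),
    h4.eventually_const_lt (by linarith : rate k α β t - δ / 4 < rate k α β t),
    tendsto_log_two_mul.eventually_gt_atTop 0, eventually_le_of_lt hαβ hp hq,
    choose_pos_eventually k, eventually_gt_atTop 0]
    with m hpm e1 e2 e3 e4 e5 hL hqp hpos hm x hx S hS i hi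
  obtain ⟨b1, b2⟩ := prod_privateLoc_bounds hk hqp hx hi (t := t) e3.le
  have hm' : (m : ℝ) ≠ 0 := by positivity
  set L := Real.log ((2 * m : ℕ) : ℝ)
  have hpm0 : 0 ≤ (p m : ℝ) := (p m).2.1
  have c1 : (p m : ℝ) * E * (S.card * (2 * m - 2).choose (k - 2) : ℕ) ≤ δ / 4 * L := by
    have h5 : (p m : ℝ) * E * (S.card * (2 * m - 2).choose (k - 2) : ℕ)
        ≤ p m * E * (s m * (2 * m - 2).choose (k - 2) : ℕ) :=
      mul_le_mul_of_nonneg_left (by exact_mod_cast Nat.mul_le_mul_right _ hS) (by positivity)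
    have h6 : (p m : ℝ) * E * (s m * (2 * m - 2).choose (k - 2) : ℕ)
        = (p m : ℝ) * (2 * m - 2).choose (k - 2) * m / L * ((s m : ℝ) / m) * E * L := by
      push_cast
      field_simp
    rw [h6] at h5
    exact h5.trans (mul_le_mul_of_nonneg_right e1.le hL.le)
  have c2 : 2 * (((p m : ℝ) * E) ^ 2 * (2 * m - 1).choose (k - 1)) ≤ δ / 4 * L := by
    have h5 : (p m : ℝ) * (2 * m - 1).choose (k - 1) = α * L := by
      rw [hpm]; field_simp
    have h6 : 2 * (((p m : ℝ) * E) ^ 2 * (2 * m - 1).choose (k - 1))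
        = p m * (2 * E ^ 2 * α) * L := by linear_combination 2 * p m * E ^ 2 * h5
    rw [h6]
    exact mul_le_mul_of_nonneg_right e2.le hL.le
  rw [div_lt_iff₀ hL] at e4
  rw [lt_div_iff₀ hL] at e5
  have hδL : 0 < δ * L := mul_pos hδ hL
  constructor
  · refine b1.trans (Real.exp_le_exp.2 ?_)
    linarith
  · refine le_trans (Real.exp_le_exp.2 ?_) b2
    linarith

/-- Below the threshold a vertex wants to change sides with probability at least `n ^ (-γ)` for
some `γ < 1`. -/
theorem exists_eventually_le_measure_wantsFlip (hk : 2 ≤ k) (hβ : 0 < β) (hαβ : β < α)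
    (hI : I₂ k α β < 1)
    (hp : ∀ᶠ m : ℕ in atTop,
      (p m : ℝ) = α * Real.log ((2 * m : ℕ) : ℝ) / ((2 * m - 1).choose (k - 1) : ℝ))
    (hq : ∀ᶠ m : ℕ in atTop,
      (q m : ℝ) = β * Real.log ((2 * m : ℕ) : ℝ) / ((2 * m - 1).choose (k - 1) : ℝ)) :
    ∃ γ : ℝ, 0 ≤ γ ∧ γ < 1 ∧ ∀ s : ℕ → ℕ, Tendsto (fun m => (s m : ℝ) / m) atTop (𝓝 0) →
      ∀ᶠ m : ℕ in atTop, ∀ x ∈ balanced (2 * m), ∀ S : Finset (Fin (2 * m)), S.card ≤ s m →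
        ∀ i ∈ S, Real.exp (-(γ * Real.log ((2 * m : ℕ) : ℝ)))
          ≤ (hypergraphLaw (2 * m) k (p m) (q m) x).real (wantsFlip k x S i) := by
  obtain ⟨t, u, ε, ht, hu, hε, h1, h2, h3⟩ := exists_tilt hk hβ hαβ hI
  obtain ⟨δ, hδ, d1, d2, d3⟩ : ∃ δ : ℝ, 0 < δ ∧ rate k α β t + t * ε + 2 * δ < 1 ∧
      rate k α β t + 3 * δ ≤ rate k α β (t - u) ∧
      rate k α β t + 3 * δ ≤ rate k α β (t + u) + u * ε := by
    refine ⟨min ((1 - (rate k α β t + t * ε)) / 4) (min ((rate k α β (t - u) - rate k α β t) / 4)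
      ((rate k α β (t + u) + u * ε - rate k α β t) / 4)), ?_, ?_, ?_, ?_⟩
    · refine lt_min (by linarith) (lt_min (by linarith) (by linarith))
    · have := min_le_left ((1 - (rate k α β t + t * ε)) / 4)
        (min ((rate k α β (t - u) - rate k α β t) / 4)
        ((rate k α β (t + u) + u * ε - rate k α β t) / 4))
      linarith
    · have := (min_le_right ((1 - (rate k α β t + t * ε)) / 4)
        (min ((rate k α β (t - u) - rate k α β t) / 4)
        ((rate k α β (t + u) + u * ε - rate k α β t) / 4))).trans (min_le_left _ _)
      linarith
    · have := (min_le_right ((1 - (rate k α β t + t * ε)) / 4)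
        (min ((rate k α β (t - u) - rate k α β t) / 4)
        ((rate k α β (t + u) + u * ε - rate k α β t) / 4))).trans (min_le_right _ _)
      linarith
  refine ⟨max 0 (rate k α β t + t * ε + 2 * δ), le_max_left _ _, max_lt one_pos d1, fun s hs => ?_⟩
  filter_upwards [eventually_prod_privateLoc_bounds hk hαβ hp hq hs t hδ,
    eventually_prod_privateLoc_bounds hk hαβ hp hq hs (t - u) hδ,
    eventually_prod_privateLoc_bounds hk hαβ hp hq hs (t + u) hδ,
    tendsto_log_two_mul.eventually_gt_atTop 0,
    (tendsto_log_two_mul.const_mul_atTop hδ).eventually_ge_atTop 3]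
    with m b1 b2 b3 hL hδL x hx S hS i hi
  have z1 := (b1 x hx S hS i hi).2
  have z2 := (b2 x hx S hS i hi).1
  have z3 := (b3 x hx S hS i hi).1
  set L := Real.log ((2 * m : ℕ) : ℝ)
  have key := exp_moment_sub_le_measure_linStat_neg
    (fun e : KSet (2 * m) k => edgeProb (p m) (q m) x e.1)
    (fun e => privateLoc x S i e.1) (a := ε * L) ht hu.le
  set Z := Real.exp (-((rate k α β t + δ) * L)) with hZ
  have hZ0 : 0 < Z := Real.exp_pos _
  -- the two correction terms are at most a quarter of the main term
  have hquarter : Real.exp (-(δ * L)) ≤ 1 / 4 := by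
    have := Real.add_one_le_exp (δ * L)
    rw [Real.exp_neg]
    refine (inv_anti₀ (by norm_num : (0 : ℝ) < 4) (by linarith)).trans (by norm_num)
  have w2 : Real.exp (-((rate k α β (t - u) - δ) * L)) ≤ Z * (1 / 4) := by
    refine le_trans ?_ (mul_le_mul_of_nonneg_left hquarter hZ0.le)
    rw [hZ, ← Real.exp_add]
    refine Real.exp_le_exp.2 ?_
    nlinarith
  have w3 : Real.exp (-(u * (ε * L))) * Real.exp (-((rate k α β (t + u) - δ) * L))
      ≤ Z * (1 / 4) := by
    refine le_trans ?_ (mul_le_mul_of_nonneg_left hquarter hZ0.le)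
    rw [hZ, ← Real.exp_add, ← Real.exp_add]
    refine Real.exp_le_exp.2 ?_
    nlinarith
  have z3' := mul_le_mul_of_nonneg_left z3 (Real.exp_pos (-(u * (ε * L)))).le
  have hmain : Z * (1 / 4) ≤ Real.exp (t * (ε * L)) *
      (hypergraphLaw (2 * m) k (p m) (q m) x).real (wantsFlip k x S i) := by
    refine le_trans ?_ key
    linarith
  have hW : Real.exp (-((rate k α β t + t * ε + 2 * δ) * L)) * Real.exp (t * (ε * L))
      ≤ Z * (1 / 4) := by
    refine le_trans (le_of_eq ?_) (mul_le_mul_of_nonneg_left hquarter hZ0.le)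
    rw [hZ, ← Real.exp_add, ← Real.exp_add]
    ring_nf
  have hmax : Real.exp (-(max 0 (rate k α β t + t * ε + 2 * δ) * L))
      ≤ Real.exp (-((rate k α β t + t * ε + 2 * δ) * L)) := by
    refine Real.exp_le_exp.2 (neg_le_neg (mul_le_mul_of_nonneg_right (le_max_right _ _) hL.le))
  refine hmax.trans (le_of_mul_le_mul_right ?_ (Real.exp_pos (t * (ε * L))))
  linarith

end Asymptotics

section Thresholds

variable {k : ℕ} {α β : ℝ} {p q : ℕ → unitInterval}

/-- Below the threshold, `x` is a minimum bisection with probability tending to zero, uniformly in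
`x`. -/
theorem exists_tendsto_measure_isMinBisection_le (hk : 2 ≤ k) (hβ : 0 < β) (hαβ : β < α)
    (hI : I₂ k α β < 1)
    (hp : ∀ᶠ m : ℕ in atTop,
      (p m : ℝ) = α * Real.log ((2 * m : ℕ) : ℝ) / ((2 * m - 1).choose (k - 1) : ℝ))
    (hq : ∀ᶠ m : ℕ in atTop,
      (q m : ℝ) = β * Real.log ((2 * m : ℕ) : ℝ) / ((2 * m - 1).choose (k - 1) : ℝ)) :
    ∃ b : ℕ → ℝ, Tendsto b atTop (𝓝 0) ∧ ∀ᶠ m : ℕ in atTop, ∀ x ∈ balanced (2 * m),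
      (hypergraphLaw (2 * m) k (p m) (q m) x).real {H | IsMinBisection H x} ≤ b m := by
  obtain ⟨γ, hγ0, hγ1, hflip⟩ := exists_eventually_le_measure_wantsFlip hk hβ hαβ hI hp hq
  obtain ⟨κ, hκ⟩ := exists_tendsto_pair_degree hk hp
  -- `n ^ γ'` candidates on each side, with `γ < γ' < 1`
  set γ' := (1 + γ) / 2 with hγ'
  set L : ℕ → ℝ := fun m => Real.log ((2 * m : ℕ) : ℝ) with hL_def
  have hLtop : Tendsto L atTop atTop := tendsto_log_two_mul
  set s : ℕ → ℕ := fun m => ⌈Real.exp (γ' * L m)⌉₊ with hs_def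
  have hs1 : ∀ m, Real.exp (γ' * L m) ≤ s m := fun m => Nat.le_ceil _
  have hs2 : ∀ᶠ m in atTop, (s m : ℝ) / m ≤ 4 * Real.exp (-((1 - γ') * L m)) := by
    filter_upwards [exp_log_two_mul, eventually_gt_atTop 0, hLtop.eventually_gt_atTop 0]
      with m hm hm0 hL
    have h1 : 1 ≤ Real.exp (γ' * L m) := Real.one_le_exp (by positivity)
    have h2 : (s m : ℝ) < Real.exp (γ' * L m) + 1 := Nat.ceil_lt_add_one (Real.exp_pos _).le
    have h3 : Real.exp (-((1 - γ') * L m)) = Real.exp (γ' * L m) / (2 * m) := by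
      rw [← hm, ← Real.exp_sub]; congr 1; simp only [L]; ring
    have hm' : (0 : ℝ) < m := by exact_mod_cast hm0
    rw [h3, div_le_iff₀ hm']
    have h4 : 4 * (Real.exp (γ' * L m) / (2 * m)) * m = 2 * Real.exp (γ' * L m) := by
      field_simp; norm_num
    rw [h4]
    linarith
  have hγ'1 : 0 < 1 - γ' := by rw [hγ']; linarith
  have hsL : Tendsto (fun m => (s m : ℝ) / m * L m) atTop (𝓝 0) := by
    have h := (tendsto_exp_neg_log_mul_log hγ'1).const_mul 4
    rw [mul_zero] at h
    refine squeeze_zero' ?_ ?_ h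
    · filter_upwards [hLtop.eventually_gt_atTop 0] with m hL
      positivity
    · filter_upwards [hs2, hLtop.eventually_gt_atTop 0] with m h1 hL
      rw [← mul_assoc]
      exact mul_le_mul_of_nonneg_right h1 hL.le
  have hsm : Tendsto (fun m => (s m : ℝ) / m) atTop (𝓝 0) := by
    refine squeeze_zero' (Eventually.of_forall fun m => by positivity) ?_ hsL
    filter_upwards [hLtop.eventually_ge_atTop 1] with m hL
    exact le_mul_of_one_le_right (by positivity) hL
  have hsm2 : Tendsto (fun m => ((2 * s m : ℕ) : ℝ) / m) atTop (𝓝 0) := by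
    have h := hsm.const_mul 2
    rw [mul_zero] at h
    refine h.congr fun m => ?_
    push_cast; ring
  refine ⟨fun m => 2 * (Real.exp (-(Real.exp (-(γ * L m)) * s m))
    + p m * (2 * s m * (2 * m - 2).choose (k - 2) : ℕ)), ?_, ?_⟩
  · have h1 : Tendsto (fun m => Real.exp (-(γ * L m)) * s m) atTop atTop := by
      refine tendsto_atTop_mono (f := fun m => Real.exp ((γ' - γ) * L m)) (fun m => ?_) ?_
      · have := mul_le_mul_of_nonneg_left (hs1 m) (Real.exp_pos (-(γ * L m))).le
        rw [← Real.exp_add] at this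
        refine le_trans (le_of_eq ?_) this
        ring_nf
      · exact Real.tendsto_exp_atTop.comp
          (hLtop.const_mul_atTop (by rw [hγ']; linarith))
    have h2 : Tendsto (fun m => (p m : ℝ) * (2 * s m * (2 * m - 2).choose (k - 2) : ℕ)) atTop
        (𝓝 0) := by
      have h := (hκ.mul hsL).const_mul 2
      rw [mul_zero, mul_zero] at h
      refine h.congr' ?_
      filter_upwards [hLtop.eventually_gt_atTop 0, eventually_gt_atTop 0] with m hL hm
      have hm' : (m : ℝ) ≠ 0 := by exact_mod_cast hm.ne'
      simp only [L] at *
      push_cast at *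
      field_simp
    have h3 := ((Real.tendsto_exp_neg_atTop_nhds_zero.comp h1).add h2).const_mul 2
    rw [add_zero, mul_zero] at h3
    exact h3
  · filter_upwards [hflip _ hsm2, hsm.eventually_lt_const one_pos, eventually_gt_atTop 0,
      eventually_le_of_lt hαβ hp hq] with m hm hlt hm0 hqp x hx
    have hm' : (0 : ℝ) < m := by exact_mod_cast hm0
    rw [div_lt_one hm'] at hlt
    have hsle : s m ≤ m := by exact_mod_cast hlt.le
    let i₀ : Fin (2 * m) := ⟨0, by omega⟩
    obtain ⟨c1, c2⟩ := card_filter_eq_of_balanced hx i₀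
    obtain ⟨T₁, hT₁, hc₁⟩ := Finset.exists_subset_card_eq (hsle.trans_eq c1.symm)
    obtain ⟨T₂, hT₂, hc₂⟩ := Finset.exists_subset_card_eq (hsle.trans_eq c2.symm)
    refine measure_isMinBisection_le hk hqp (T₁ := T₁) (T₂ := T₂) ?_ hc₁ hc₂ ?_
    · intro i hi j hj h
      have h1 := (Finset.mem_filter.1 (hT₁ hi)).2
      have h2 := (Finset.mem_filter.1 (hT₂ hj)).2
      exact h2 (h ▸ h1)
    · refine hm x hx _ ((Finset.card_union_le _ _).trans ?_)
      omega

/-! ### Above the threshold -/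

/-- Chernoff's bounds for all competitors at once: a small exponential in the size of `A`, or, for
`A` of linear size, a bound that beats the number of all competitors. -/
theorem exists_eventually_measure_flip_le (hk : 2 ≤ k) (hβ : 0 < β) (hαβ : β < α)
    (hI : 1 < I₂ k α β)
    (hp : ∀ᶠ m : ℕ in atTop,
      (p m : ℝ) = α * Real.log ((2 * m : ℕ) : ℝ) / ((2 * m - 1).choose (k - 1) : ℝ))
    (hq : ∀ᶠ m : ℕ in atTop,
      (q m : ℝ) = β * Real.log ((2 * m : ℕ) : ℝ) / ((2 * m - 1).choose (k - 1) : ℝ)) :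
    ∃ δ c : ℝ, 0 < δ ∧ 0 < c ∧ ∀ᶠ m : ℕ in atTop, ∀ x ∈ balanced (2 * m),
      ∀ A : Finset (Fin (2 * m)), A.card ≤ m → flip A x ∈ balanced (2 * m) →
      (hypergraphLaw (2 * m) k (p m) (q m) x).real
          {H | bisectionObj H x ≤ bisectionObj H (flip A x)}
        ≤ Real.exp (-((1 + δ) * Real.log ((2 * m : ℕ) : ℝ))) ^ A.card
          + Real.exp (-(c * Real.log ((2 * m : ℕ) : ℝ) * m)) := by
  obtain ⟨⟨t, ht, htI⟩, -⟩ := isGreatest_I₂ hk (hβ.trans hαβ).le hβ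
  have ht0 : 0 ≤ t := ht
  have hα : 0 < α := hβ.trans hαβ
  have hk0 : (0 : ℝ) < k := by exact_mod_cast (by omega : 0 < k)
  obtain ⟨κ, hκ⟩ := exists_tendsto_pair_degree hk hp
  obtain ⟨μ, hμ, hμt⟩ := exists_tendsto_cluster_excess hk hαβ hp hq
  set δ := (I₂ k α β - 1) / 3 with hδ_def
  have hδ : 0 < δ := by rw [hδ_def]; linarith
  set E := 1 + Real.exp (t * (k : ℝ) ^ 2)
  have hE : 0 < E := by positivity
  set M := E * (|κ| + 1) with hM
  have hM0 : 0 < M := by positivity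
  -- sets of size at most `η m` count as small
  set η := min 1 (δ / M) with hη
  have hη0 : 0 < η := lt_min one_pos (by positivity)
  have hη1 : η ≤ 1 := min_le_left _ _
  have hηM : M * η ≤ δ := by
    have h1 : η ≤ δ / M := min_le_right _ _
    rw [le_div_iff₀ hM0] at h1; linarith
  set a := μ / 4 * η with ha
  have ha0 : 0 < a := by positivity
  set B := (k : ℝ) ^ 4 * (2 * α / k) with hB
  have hB0 : 0 < B := by positivity
  set θ := min (1 / (k : ℝ) ^ 2) (a / (2 * B)) with hθ
  have hθ0 : 0 < θ := lt_min (by positivity) (by positivity)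
  have hθk : θ * (k : ℝ) ^ 2 ≤ 1 := by
    have h1 : θ ≤ 1 / (k : ℝ) ^ 2 := min_le_left _ _
    rwa [le_div_iff₀ (by positivity)] at h1
  have hθB : θ * B ≤ a / 2 := by
    have h1 : θ ≤ a / (2 * B) := min_le_right _ _
    rw [le_div_iff₀ (by positivity)] at h1; linarith
  refine ⟨δ, θ * a / 2, hδ, by positivity, ?_⟩
  filter_upwards [(tendsto_degExp_div_log hk hp hq t).eventually_const_lt
      (by rw [htI, hδ_def]; linarith : 1 + 2 * δ < rate k α β t),
    hκ.eventually_lt_const (by linarith [le_abs_self κ] : κ < |κ| + 1),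
    hμt.eventually_const_lt (by linarith : μ / 2 < μ),
    edgeProb_mul_choose hk hp, tendsto_log_two_mul.eventually_gt_atTop 0,
    eventually_le_of_lt hαβ hp hq, eventually_gt_atTop 0]
    with m e1 e2 e3 e4 hL hqp hm x hx A hA hy
  set L := Real.log ((2 * m : ℕ) : ℝ)
  have hm' : (0 : ℝ) < m := by exact_mod_cast hm
  rw [lt_div_iff₀ hL] at e1 e3
  rw [div_lt_iff₀ hL] at e2
  rcases le_total (A.card : ℝ) (η * m) with hsmall | hlarge
  · refine le_trans ?_ (le_add_of_nonneg_right (Real.exp_pos _).le)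
    refine (measure_flip_le_small hk hqp hx A ht0).trans ?_
    rw [← Real.exp_nat_mul]
    refine Real.exp_le_exp.2 ?_
    rw [mul_neg, neg_le_neg_iff]
    refine mul_le_mul_of_nonneg_left ?_ (Nat.cast_nonneg _)
    have hp0 : 0 ≤ (p m : ℝ) := (p m).2.1
    have h1 : (p m : ℝ) * E * (A.card * (2 * m - 2).choose (k - 2) : ℕ) ≤ δ * L := by
      push_cast
      calc (p m : ℝ) * E * (A.card * (2 * m - 2).choose (k - 2))
          ≤ p m * E * (η * m * (2 * m - 2).choose (k - 2)) := by gcongr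
        _ = η * E * (p m * (2 * m - 2).choose (k - 2) * m) := by ring
        _ ≤ η * E * ((|κ| + 1) * L) := by gcongr
        _ = M * η * L := by rw [hM]; ring
        _ ≤ δ * L := by gcongr
    linarith
  · refine le_trans ?_ (le_add_of_nonneg_left (by positivity))
    refine (measure_flip_le_large hk hqp hx A hy hθ0.le hθk).trans (Real.exp_le_exp.2 ?_)
    rw [neg_le_neg_iff, e4]
    have hA' : (A.card : ℝ) ≤ m := by exact_mod_cast hA
    have h1 : η * m * m ≤ (m : ℝ) ^ 2 - (m - A.card) ^ 2 := by nlinarith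
    have h2 : 0 ≤ ((p m : ℝ) - q m) / 2 * (m - 2).choose (k - 2) := by
      have : 0 ≤ (p m : ℝ) - q m := by linarith
      positivity
    have h3 : a * L * m ≤ ((p m : ℝ) - q m) / 2 * ((m - 2).choose (k - 2) *
        ((m : ℝ) ^ 2 - (m - A.card) ^ 2)) := by
      calc a * L * m = μ / 2 * L * (η * m / 2) := by rw [ha]; ring
        _ ≤ (((p m : ℝ) - q m) * (m - 2).choose (k - 2) * m) * (η * m / 2) := by gcongr
        _ = ((p m : ℝ) - q m) / 2 * (m - 2).choose (k - 2) * (η * m * m) := by ring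
        _ ≤ ((p m : ℝ) - q m) / 2 * (m - 2).choose (k - 2) *
            ((m : ℝ) ^ 2 - (m - A.card) ^ 2) := mul_le_mul_of_nonneg_left h1 h2
        _ = _ := by ring
    have h4 : θ ^ 2 * ((k : ℝ) ^ 4 * (α * L * (2 * m) / k)) = θ * (θ * B) * (L * m) := by
      rw [hB]; ring
    have h5 : θ * (θ * B) * (L * m) ≤ θ * (a / 2) * (L * m) := by gcongr
    have h6 := mul_le_mul_of_nonneg_left h3 hθ0.le
    rw [h4]
    linarith

theorem sum_pow_card_eq {ι : Type*} [Fintype ι] (z : ℝ) :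
    ∑ A : Finset ι, z ^ A.card = (1 + z) ^ Fintype.card ι := by
  have := Fintype.sum_pow_mul_eq_add_pow ι z 1
  simpa [add_comm] using this

/-- Above the threshold, the probability that some balanced `y ≠ ±x` does at least as well as `x`
tends to zero, uniformly in `x`. -/
theorem exists_tendsto_measure_exists_competitor_le (hk : 2 ≤ k) (hβ : 0 < β) (hαβ : β < α)
    (hI : 1 < I₂ k α β)
    (hp : ∀ᶠ m : ℕ in atTop,
      (p m : ℝ) = α * Real.log ((2 * m : ℕ) : ℝ) / ((2 * m - 1).choose (k - 1) : ℝ))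
    (hq : ∀ᶠ m : ℕ in atTop,
      (q m : ℝ) = β * Real.log ((2 * m : ℕ) : ℝ) / ((2 * m - 1).choose (k - 1) : ℝ)) :
    ∃ b : ℕ → ℝ, Tendsto b atTop (𝓝 0) ∧ ∀ᶠ m : ℕ in atTop, ∀ x ∈ balanced (2 * m),
      (hypergraphLaw (2 * m) k (p m) (q m) x).real
        {H | ∃ y ∈ balanced (2 * m), y ≠ x ∧ y ≠ -x ∧ bisectionObj H x ≤ bisectionObj H y}
        ≤ b m := by
  classical
  obtain ⟨δ, c, hδ, hc, hev⟩ := exists_eventually_measure_flip_le hk hβ hαβ hI hp hq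
  refine ⟨fun m => (Real.exp (Real.exp (-(δ * Real.log ((2 * m : ℕ) : ℝ)))) - 1)
    + Real.exp (-(m : ℝ)), ?_, ?_⟩
  · have h1 : Tendsto (fun m : ℕ => Real.exp (-(δ * Real.log ((2 * m : ℕ) : ℝ)))) atTop (𝓝 0) :=
      Real.tendsto_exp_neg_atTop_nhds_zero.comp (tendsto_log_two_mul.const_mul_atTop hδ)
    have h2 := ((Real.continuous_exp.tendsto 0).comp h1).sub_const 1
    have h3 := h2.add (Real.tendsto_exp_neg_atTop_nhds_zero.comp
      (tendsto_natCast_atTop_atTop (R := ℝ)))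
    simpa using h3
  · filter_upwards [hev, exp_log_two_mul,
      (tendsto_log_two_mul.const_mul_atTop hc).eventually_ge_atTop 3,
      eventually_gt_atTop 0] with m hm hexp hcL hm0 x hx
    set L := Real.log ((2 * m : ℕ) : ℝ)
    set z := Real.exp (-((1 + δ) * L))
    have hz : 0 < z := Real.exp_pos _
    set 𝒜 : Finset (Finset (Fin (2 * m))) := Finset.univ.filter fun A =>
      A ≠ ∅ ∧ A.card ≤ m ∧ flip A x ∈ balanced (2 * m)
    -- up to a global sign, a competitor differs from `x` on at most half of the vertices
    have hsub : {H : Hypergraph (2 * m) k | ∃ y ∈ balanced (2 * m), y ≠ x ∧ y ≠ -x ∧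
        bisectionObj H x ≤ bisectionObj H y}
        ⊆ ⋃ A ∈ 𝒜, {H | bisectionObj H x ≤ bisectionObj H (flip A x)} := by
      rintro H ⟨y, hy, hyx, hyx', hobj⟩
      have main : ∀ y ∈ balanced (2 * m), y ≠ x → bisectionObj H x ≤ bisectionObj H y →
          (Finset.univ.filter fun i => x i ≠ y i).card ≤ m →
          H ∈ ⋃ A ∈ 𝒜, {H | bisectionObj H x ≤ bisectionObj H (flip A x)} := by
        intro y hy hyx hobj hcard
        have hfl := flip_filter_ne x y
        refine Set.mem_biUnion (x := Finset.univ.filter fun i => x i ≠ y i) ?_ ?_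
        · simp only [𝒜, Finset.coe_filter, Finset.mem_univ, true_and, Set.mem_ofPred_eq]
          refine ⟨fun h => hyx ?_, hcard, hfl.symm ▸ hy⟩
          rw [h] at hfl
          rw [← hfl]
          ext i
          simp [flip]
        · rw [Set.mem_ofPred_eq, hfl]
          exact hobj
      by_cases hcard : (Finset.univ.filter fun i => x i ≠ y i).card ≤ m
      · exact main y hy hyx hobj hcard
      · refine main (-y) (neg_mem_balanced hy) (fun h => hyx' (by rw [← h, neg_neg]))
          (by rwa [bisectionObj_neg]) ?_
        have h1 : (Finset.univ.filter fun i => x i ≠ (-y) i)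
            = Finset.univ.filter fun i => ¬ x i ≠ y i := by
          ext i
          simp only [Finset.mem_filter, Finset.mem_univ, true_and, Pi.neg_apply]
          rcases Int.units_eq_one_or (x i) with h1 | h1 <;>
            rcases Int.units_eq_one_or (y i) with h2 | h2 <;> simp [h1, h2]
        have h2 := Finset.card_filter_add_card_filter_not
          (s := (Finset.univ : Finset (Fin (2 * m))))
          (fun i => x i ≠ y i)
        rw [Finset.card_univ, Fintype.card_fin] at h2
        rw [h1]
        omega
    refine (measureReal_mono hsub (measure_ne_top _ _)).trans
      ((measureReal_biUnion_finset_le _ _).trans ?_)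
    calc ∑ A ∈ 𝒜, (hypergraphLaw (2 * m) k (p m) (q m) x).real
          {H | bisectionObj H x ≤ bisectionObj H (flip A x)}
        ≤ ∑ A ∈ 𝒜, (z ^ A.card + Real.exp (-(c * L * m))) := by
          refine Finset.sum_le_sum fun A hA => ?_
          obtain ⟨-, -, h1, h2⟩ := Finset.mem_filter.1 hA
          exact hm x hx A h1 h2
      _ ≤ ∑ A ∈ (Finset.univ : Finset (Finset (Fin (2 * m)))).erase ∅,
          (z ^ A.card + Real.exp (-(c * L * m))) := by
          refine Finset.sum_le_sum_of_subset_of_nonneg (fun A hA => ?_) fun A _ _ => by positivity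
          exact Finset.mem_erase.2 ⟨(Finset.mem_filter.1 hA).2.1, Finset.mem_univ _⟩
      _ ≤ ((1 + z) ^ (2 * m) - 1) + 2 ^ (2 * m) * Real.exp (-(c * L * m)) := by
          rw [Finset.sum_add_distrib]
          refine add_le_add (le_of_eq ?_) ?_
          · have h1 := sum_pow_card_eq (ι := Fin (2 * m)) z
            rw [← Finset.add_sum_erase _ _ (Finset.mem_univ ∅), Fintype.card_fin] at h1
            rw [← h1, Finset.card_empty, pow_zero, add_sub_cancel_left]
          · rw [Finset.sum_const, nsmul_eq_mul]
            refine mul_le_mul_of_nonneg_right ?_ (Real.exp_pos _).le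
            have h1 := Finset.card_le_univ ((Finset.univ : Finset (Finset (Fin (2 * m)))).erase ∅)
            rw [Fintype.card_finset, Fintype.card_fin] at h1
            exact_mod_cast h1
      _ ≤ (Real.exp (Real.exp (-(δ * L))) - 1) + Real.exp (-(m : ℝ)) := by
          refine add_le_add (sub_le_sub_right ?_ 1) ?_
          · have h1 : Real.exp (-(δ * L)) = (2 * m : ℕ) * z := by
              push_cast
              rw [← hexp, ← Real.exp_add]
              ring_nf
            rw [h1, Real.exp_nat_mul]
            refine pow_le_pow_left₀ (by positivity) ?_ _
            linarith [Real.add_one_le_exp z]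
          · have h1 : (2 : ℝ) ≤ Real.exp 1 := by linarith [Real.add_one_le_exp (1 : ℝ)]
            have h2 : (2 : ℝ) ^ (2 * m) ≤ Real.exp (2 * m) := by
              have := pow_le_pow_left₀ (by norm_num) h1 (2 * m)
              rw [← Real.exp_nat_mul] at this
              refine this.trans (le_of_eq ?_)
              push_cast; ring_nf
            refine (mul_le_mul_of_nonneg_right h2 (Real.exp_pos _).le).trans ?_
            rw [← Real.exp_add]
            refine Real.exp_le_exp.2 ?_
            have h3 : (0 : ℝ) ≤ m := Nat.cast_nonneg m
            nlinarith

end Thresholds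

/-! ### Averaging over the labels -/

theorem balanced_nonempty (m : ℕ) : (balanced (2 * m)).Nonempty := by
  refine ⟨fun i => (-1) ^ (i : ℕ), ?_⟩
  simp only [balanced, Set.mem_ofPred_eq, Units.val_pow_eq_pow_val, Units.val_neg, Units.val_one]
  rw [Fin.sum_univ_eq_sum_range fun i => (-1 : ℤ) ^ i]
  induction m with
  | zero => simp
  | succ m ih =>
    rw [show 2 * (m + 1) = 2 * m + 1 + 1 by ring, Finset.sum_range_succ, Finset.sum_range_succ, ih,
      pow_succ]
    ring

theorem isProbabilityMeasure_hsbm (m k : ℕ) (p q : I) :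
    IsProbabilityMeasure (hsbm (2 * m) k p q) := by
  have := isProbabilityMeasure_uniformOn (Set.toFinite _) (balanced_nonempty m)
  unfold hsbm
  infer_instance

/-- A bound given every balanced labelling is a bound for the joint law. -/
theorem hsbm_real_le {n k : ℕ} {p q : I} {s : Set (Labeling n × Hypergraph n k)} {b : ℝ}
    (hb : 0 ≤ b) (h : ∀ x ∈ balanced n, (hypergraphLaw n k p q x).real {H | (x, H) ∈ s} ≤ b) :
    (hsbm n k p q).real s ≤ b := by
  have hs : MeasurableSet s := s.toFinite.measurableSet
  refine ENNReal.toReal_le_of_le_ofReal hb ?_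
  rw [hsbm, Measure.compProd_apply hs]
  calc ∫⁻ x, Kernel.ofFunOfCountable (hypergraphLaw n k p q) x (Prod.mk x ⁻¹' s)
        ∂uniformOn (balanced n)
      ≤ ∫⁻ _, ENNReal.ofReal b ∂uniformOn (balanced n) := by
        refine lintegral_mono_ae ?_
        have hae : ∀ᵐ x ∂uniformOn (balanced n), x ∈ balanced n :=
          ae_cond_mem (balanced n).toFinite.measurableSet
        filter_upwards [hae] with x hx
        exact (ENNReal.le_ofReal_iff_toReal_le (measure_ne_top _ _) hb).2 (h x hx)
    _ ≤ ENNReal.ofReal b := by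
        rw [lintegral_const]
        exact mul_le_of_le_one_right' prob_le_one

theorem tendsto_hsbm_real_one {k : ℕ} {p q : ℕ → I}
    {s : ∀ m : ℕ, Set (Labeling (2 * m) × Hypergraph (2 * m) k)} {b : ℕ → ℝ}
    (hb : Tendsto b atTop (𝓝 0))
    (h : ∀ᶠ m : ℕ in atTop, ∀ x ∈ balanced (2 * m),
      (hypergraphLaw (2 * m) k (p m) (q m) x).real {H | (x, H) ∉ s m} ≤ b m) :
    Tendsto (fun m => (hsbm (2 * m) k (p m) (q m)).real (s m)) atTop (𝓝 1) := by
  have h1 : Tendsto (fun m => 1 - b m) atTop (𝓝 1) := by simpa using hb.const_sub 1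
  have := isProbabilityMeasure_hsbm
  refine tendsto_of_tendsto_of_tendsto_of_le_of_le' h1 tendsto_const_nhds ?_
    (Eventually.of_forall fun m => measureReal_le_one)
  filter_upwards [h] with m hm
  have hs : MeasurableSet (s m) := (s m).toFinite.measurableSet
  have hb0 : 0 ≤ b m := by
    obtain ⟨x, hx⟩ := balanced_nonempty m
    exact measureReal_nonneg.trans (hm x hx)
  have h2 := hsbm_real_le (s := (s m)ᶜ) hb0 hm
  rw [probReal_compl_eq_one_sub hs] at h2
  linarith

/-! ### The estimators -/

theorem isMinBisection_of_eq_or_eq_neg {n k : ℕ} {H : Hypergraph n k} {x y : Labeling n}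
    (hy : IsMinBisection H y) (h : y = x ∨ y = -x) : IsMinBisection H x := by
  rcases h with rfl | rfl
  · exact hy
  · refine ⟨neg_neg x ▸ neg_mem_balanced hy.1, fun z hz => ?_⟩
    rw [← bisectionObj_neg H x]
    exact hy.2 z hz

theorem outer_mem_sdpFeasible {n : ℕ} {x : Labeling n} (hx : x ∈ balanced n) :
    outer x ∈ sdpFeasible n := by
  refine ⟨?_, fun i => sgn_mul_self x i, ?_⟩
  · have h := (mem_balanced_iff x).1 hx
    have : ∑ i, ∑ j, outer x i j = (∑ i, sgn x i) * ∑ j, sgn x j := by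
      rw [Finset.sum_mul_sum]; rfl
    rw [this, h, zero_mul]
  · exact Matrix.posSemidef_vecMulVec_self_star (sgn x)

theorem sdpObj_outer {n k : ℕ} (H : Hypergraph n k) (x : Labeling n) :
    sdpObj H (outer x) = bisectionObj H x := by
  simp [sdpObj, bisectionObj, outer, mul_assoc]

theorem isMinBisection_of_isSDPOptimal {n k : ℕ} {H : Hypergraph n k} {x : Labeling n}
    (hx : x ∈ balanced n) (h : IsSDPOptimal H (outer x)) : IsMinBisection H x := by
  refine ⟨hx, fun y hy => ?_⟩
  have := h.2 _ (outer_mem_sdpFeasible hy)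
  rw [sdpObj_outer, sdpObj_outer] at this
  exact_mod_cast this

end HSBM

theorem theorem3 (k : ℕ) (hk : 2 ≤ k) (α β : ℝ) (hβ : 0 < β) (hαβ : β < α)
    (p q : ℕ → unitInterval)
    (hp : ∀ᶠ m : ℕ in atTop,
      (p m : ℝ) = α * Real.log ((2 * m : ℕ) : ℝ) / ((2 * m - 1).choose (k - 1) : ℝ))
    (hq : ∀ᶠ m : ℕ in atTop,
      (q m : ℝ) = β * Real.log ((2 * m : ℕ) : ℝ) / ((2 * m - 1).choose (k - 1) : ℝ)) :
    IsGreatest (HSBM.rate k α β '' Set.Ici 0) (HSBM.I₂ k α β) ∧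
    (HSBM.I₂ k α β < 1 →
      (∀ σtrunc : ∀ m : ℕ, HSBM.Hypergraph (2 * m) k → HSBM.Labeling (2 * m),
        (∀ m H, HSBM.IsMinBisection H (σtrunc m H)) →
        Tendsto (fun m : ℕ => (HSBM.hsbm (2 * m) k (p m) (q m)).real
          {ω | σtrunc m ω.2 ≠ ω.1 ∧ σtrunc m ω.2 ≠ -ω.1}) atTop (𝓝 1)) ∧
      (∀ Xsdp : ∀ m : ℕ, HSBM.Hypergraph (2 * m) k → Matrix (Fin (2 * m)) (Fin (2 * m)) ℝ,
        (∀ m H, HSBM.IsSDPOptimal H (Xsdp m H)) →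
        Tendsto (fun m : ℕ => (HSBM.hsbm (2 * m) k (p m) (q m)).real
          {ω | Xsdp m ω.2 ≠ HSBM.outer ω.1}) atTop (𝓝 1))) ∧
    (1 < HSBM.I₂ k α β →
      ∀ σtrunc : ∀ m : ℕ, HSBM.Hypergraph (2 * m) k → HSBM.Labeling (2 * m),
        (∀ m H, HSBM.IsMinBisection H (σtrunc m H)) →
        Tendsto (fun m : ℕ => (HSBM.hsbm (2 * m) k (p m) (q m)).real
          {ω | σtrunc m ω.2 = ω.1 ∨ σtrunc m ω.2 = -ω.1}) atTop (𝓝 1)) := by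
  refine ⟨HSBM.isGreatest_I₂ hk (hβ.trans hαβ).le hβ, fun hI => ⟨fun σtrunc hσ => ?_,
    fun Xsdp hX => ?_⟩, fun hI σtrunc hσ => ?_⟩
  · obtain ⟨b, hb, hev⟩ := HSBM.exists_tendsto_measure_isMinBisection_le hk hβ hαβ hI hp hq
    refine HSBM.tendsto_hsbm_real_one hb ?_
    filter_upwards [hev] with m hm x hx
    refine (measureReal_mono fun H hH => ?_).trans (hm x hx)
    simp only [Set.mem_ofPred_eq, not_and_or, not_not] at hH
    exact HSBM.isMinBisection_of_eq_or_eq_neg (hσ m H) hH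
  · obtain ⟨b, hb, hev⟩ := HSBM.exists_tendsto_measure_isMinBisection_le hk hβ hαβ hI hp hq
    refine HSBM.tendsto_hsbm_real_one hb ?_
    filter_upwards [hev] with m hm x hx
    refine (measureReal_mono fun H hH => ?_).trans (hm x hx)
    simp only [Set.mem_ofPred_eq, not_not] at hH
    exact HSBM.isMinBisection_of_isSDPOptimal hx (hH ▸ hX m H)
  · obtain ⟨b, hb, hev⟩ := HSBM.exists_tendsto_measure_exists_competitor_le hk hβ hαβ hI hp hq
    refine HSBM.tendsto_hsbm_real_one hb ?_
    filter_upwards [hev] with m hm x hx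
    refine (measureReal_mono fun H hH => ?_).trans (hm x hx)
    simp only [Set.mem_ofPred_eq, not_or] at hH
    exact ⟨σtrunc m H, (hσ m H).1, hH.1, hH.2, (hσ m H).2 x hx⟩
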